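/- **Setting.** Let $K\ge 2$ and $D\ge 0$ be integers, and let $z^{(q)}=(z^{(q)}_1,\dots,z^{(q)}_K)$ (query slots) and $z^{(c)}=(z^{(c)}_1,\dots,z^{(c)}_K)$ (support slots) be tuples of unit vectors, i.e. points of the unit sphere $\mathcal S^{D-1}\subset\mathbb R^D$. Put $\cos(x,y)=\langle x,y\rangle/(\|x\|\|y\|)$ and $S_{k,k'}=\cos(z^{(q)}_k,z^{(c)}_{k'})$. For $\varepsilon>0$ let $$T(\varepsilon)=\arg\min_{T}\ \langle T,-S\rangle-\varepsilon H(T),\qquad H(T)=-\sum_{k,k'}T_{k,k'}\log T_{k,k'},$$ the minimum being over the $K\times K$ doubly stochastic matrices (all row and column sums equal to $1$). This $T=T(\varepsilon)$ is a function of the slots; let $s_T=\frac1K\sum_{k,k'}T_{k,k'}\cos(z^{(q)}_k,z^{(c)}_{k'})$. Write $\Pi^\perp_z(v)=v-\langle z,v\rangle z$, and let $\partial/\partial z^{(q)}_k$ denote the Euclidean gradient in $\mathbb R^D$ with respect to the $k$-th query slot. Set $$G^{\mathrm{dir}}_k=\tfrac1K\Pi^\perp_{z^{(q)}_k}\Bigl(\sum_{k'}T_{k,k'}z^{(c)}_{k'}\Bigr),\qquad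 G^{\mathrm{ind}}_k=\tfrac1K\sum_{j,j'}\frac{\partial T_{j,j'}}{\partial z^{(q)}_k}\cos(z^{(q)}_j,z^{(c)}_{j'}),\qquad G_k=\frac{\partial s_T}{\partial z^{(q)}_k}.$$ Let $\Delta_{\min}=\min_k\bigl(\max_{k'}S_{k,k'}-\text{second-max}_{k'}S_{k,k'}\bigr)$, where the second maximum is counted with multiplicity. **Lemma.** For every $K\ge2$ and every $\delta>0$ there are $\varepsilon_{\mathrm{crit}},C,c>0$, depending only on $K$ and $\delta$, such that the following holds for every $D$. Suppose that $(z^{(q)},z^{(c)})$ satisfies (a) $\Delta_{\min}=\delta>0$ (no ties for the row maxima), and (b) the row-wise greedy assignment $k\mapsto k^*(k)=\arg\max_{k'}S_{k,k'}$ is a permutation of $\{1,\dots,K\}$. Then for all $0<\varepsilon<\varepsilon_{\mathrm{crit}}$ and all $k$: 1. (Concentration) $T_{k,k^*(k)}(\varepsilon)\ge 1-Ce^{-c/\varepsilon}$. 2. (Direct term) $\bigl\|G^{\mathrm{dir}}_k-\tfrac1K\Pi^\perp_{z^{(q)}_k}(z^{(c)}_{k^*(k)})\bigr\|\le Ce^{-c/\varepsilon}$;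 the vector subtracted is the hard-Chamfer gradient. 3. (Indirect term) All entries of $T(\varepsilon)$ are differentiable in $z^{(q)}_k$, $G_k=G^{\mathrm{dir}}_k+G^{\mathrm{ind}}_k$, and $\|G^{\mathrm{ind}}_k\|\le C\varepsilon^{-1}e^{-c/\varepsilon}$; in particular $G^{\mathrm{ind}}_k\to0$ as $\varepsilon\to0^+$. Moreover: 4. (Rank) If $D\ge 2K$, then for every $0<\varepsilon<\varepsilon_{\mathrm{crit}}$ the Jacobian $[G_1,\dots,G_K]^\top\in\mathbb R^{K\times D}$ has rank $K$ generically: for every probability measure $\mu$ on $(\mathcal S^{D-1})^K\times(\mathcal S^{D-1})^K$ that is absolutely continuous with respect to the product of the surface measures, $$\mu\bigl(\{(z^{(q)},z^{(c)}):\ \mathrm{rank}\,[G_1,\dots,G_K]^\top<K\}\bigr)=0 .$$ -/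

import Mathlib

open MeasureTheory Filter Topology

noncomputable section

namespace SlotMatching

/-- Cosine similarity `⟨x, y⟩ / (‖x‖ ‖y‖)`. -/
def cosSim {D : ℕ} (x y : EuclideanSpace ℝ (Fin D)) : ℝ :=
  inner ℝ x y / (‖x‖ * ‖y‖)

/-- The similarity matrix `S k k' = cos (q k, c k')` of query slots `q` and support slots `c`. -/
def simMatrix {K D : ℕ} (q c : Fin K → EuclideanSpace ℝ (Fin D)) : Matrix (Fin K) (Fin K) ℝ :=
  Matrix.of fun k k' => cosSim (q k) (c k')

/-- The largest entry of row `k`. -/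
def rowMax {K : ℕ} (S : Matrix (Fin K) (Fin K) ℝ) (k : Fin K) : ℝ :=
  ⨆ k', S k k'

/-- The second largest entry of row `k`, counted with multiplicity: the smallest value that the
maximum of the row can take after one of its entries is deleted (meaningful for `2 ≤ K`). -/
def rowSecondMax {K : ℕ} (S : Matrix (Fin K) (Fin K) ℝ) (k : Fin K) : ℝ :=
  ⨅ j : Fin K, ⨆ k' : {k' : Fin K // k' ≠ j}, S k k'

/-- The smallest gap, over the rows, between the largest and the second largest entry. -/
def minGap {K : ℕ} (S : Matrix (Fin K) (Fin K) ℝ) : ℝ :=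
  ⨅ k, (rowMax S k - rowSecondMax S k)

/-- `f` picks in every row of `S` the index of a largest entry. -/
def IsRowArgmax {K : ℕ} (S : Matrix (Fin K) (Fin K) ℝ) (f : Fin K → Fin K) : Prop :=
  ∀ k k', S k k' ≤ S k (f k)

/-- The entropy `H(T) = - ∑ T k k' log (T k k')`, with `0 log 0 = 0`. -/
def entropy {K : ℕ} (T : Matrix (Fin K) (Fin K) ℝ) : ℝ :=
  -∑ k, ∑ k', T k k' * Real.log (T k k')

/-- The objective `⟨T, -S⟩ - ε H(T)` of entropic optimal transport. -/
def otObjective {K : ℕ} (ε : ℝ) (S T : Matrix (Fin K) (Fin K) ℝ) : ℝ :=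
  (∑ k, ∑ k', T k k' * (-S k k')) - ε * entropy T

/-- `T` minimizes the entropic optimal transport objective over the doubly stochastic matrices. -/
def IsEntropicCoupling {K : ℕ} (ε : ℝ) (S T : Matrix (Fin K) (Fin K) ℝ) : Prop :=
  T ∈ doublyStochastic ℝ (Fin K) ∧
    ∀ T' ∈ doublyStochastic ℝ (Fin K), otObjective ε S T ≤ otObjective ε S T'

theorem continuous_otObjective {K : ℕ} (ε : ℝ) (S : Matrix (Fin K) (Fin K) ℝ) :
    Continuous (otObjective ε S) := by
  have h : ∀ k k' : Fin K, Continuous fun T : Matrix (Fin K) (Fin K) ℝ => T k k' :=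
    fun k k' => continuous_id.matrix_elem k k'
  unfold otObjective entropy
  refine Continuous.sub ?_ (continuous_const.mul (Continuous.neg ?_))
  · exact continuous_finsetSum _ fun k _ => continuous_finsetSum _ fun k' _ =>
      (h k k').mul continuous_const
  · exact continuous_finsetSum _ fun k _ => continuous_finsetSum _ fun k' _ =>
      Real.continuous_mul_log.comp (h k k')

theorem isCompact_doublyStochastic (K : ℕ) :
    IsCompact (doublyStochastic ℝ (Fin K) : Set (Matrix (Fin K) (Fin K) ℝ)) := by
  have h : ∀ k k' : Fin K, Continuous fun T : Matrix (Fin K) (Fin K) ℝ => T k k' :=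
    fun k k' => continuous_id.matrix_elem k k'
  have hb : IsCompact (Set.pi Set.univ fun _ : Fin K => Set.pi Set.univ fun _ : Fin K =>
      Set.Icc (0 : ℝ) 1) :=
    isCompact_univ_pi fun _ => isCompact_univ_pi fun _ => isCompact_Icc
  refine hb.of_isClosed_subset ?_ ?_
  · have : (doublyStochastic ℝ (Fin K) : Set (Matrix (Fin K) (Fin K) ℝ)) =
        (⋂ i, ⋂ j, {T | 0 ≤ T i j}) ∩ ((⋂ i, {T | ∑ j, T i j = 1}) ∩
          (⋂ j, {T | ∑ i, T i j = 1})) := by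
      ext T
      simp [mem_doublyStochastic_iff_sum]
    rw [this]
    refine IsClosed.inter ?_ (IsClosed.inter ?_ ?_)
    · exact isClosed_iInter fun i => isClosed_iInter fun j => isClosed_le continuous_const (h i j)
    · exact isClosed_iInter fun i =>
        isClosed_eq (continuous_finsetSum _ fun j _ => h i j) continuous_const
    · exact isClosed_iInter fun j =>
        isClosed_eq (continuous_finsetSum _ fun i _ => h i j) continuous_const
  · intro T hT
    obtain ⟨h0, h1, -⟩ := mem_doublyStochastic_iff_sum.1 hT
    intro i _ j _
    refine ⟨h0 i j, ?_⟩
    rw [← h1 i]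
    exact Finset.single_le_sum (f := fun j => T i j) (fun j _ => h0 i j) (Finset.mem_univ j)

theorem exists_isEntropicCoupling {K : ℕ} (ε : ℝ) (S : Matrix (Fin K) (Fin K) ℝ) :
    ∃ T, IsEntropicCoupling ε S T := by
  obtain ⟨T, hT, hmin⟩ := (isCompact_doublyStochastic K).exists_isMinOn
    ⟨1, one_mem _⟩ (continuous_otObjective ε S).continuousOn
  exact ⟨T, hT, fun T' hT' => hmin hT'⟩

/-- For `ε > 0` the minimizer is unique, so that the choice below is the arg min. -/
theorem IsEntropicCoupling.unique {K : ℕ} {ε : ℝ} (hε : 0 < ε) {S T T' : Matrix (Fin K) (Fin K) ℝ}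
    (hT : IsEntropicCoupling ε S T) (hT' : IsEntropicCoupling ε S T') : T = T' := by
  by_contra hne
  obtain ⟨i, j, hij⟩ : ∃ i j, T i j ≠ T' i j := by
    by_contra! h
    exact hne (Matrix.ext h)
  set M : Matrix (Fin K) (Fin K) ℝ := (1 / 2 : ℝ) • T + (1 / 2 : ℝ) • T' with hM
  have hMmem : M ∈ doublyStochastic ℝ (Fin K) :=
    convex_doublyStochastic hT.1 hT'.1 (by norm_num) (by norm_num) (by norm_num)
  have h0 := (mem_doublyStochastic_iff_sum.1 hT.1).1
  have h0' := (mem_doublyStochastic_iff_sum.1 hT'.1).1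
  have hMe : ∀ k k', M k k' = (1 / 2 : ℝ) * T k k' + (1 / 2 : ℝ) * T' k k' := by
    intro k k'
    simp [hM]
  have hle : ∀ k k', M k k' * Real.log (M k k') ≤
      (1 / 2 : ℝ) * (T k k' * Real.log (T k k')) + (1 / 2 : ℝ) * (T' k k' * Real.log (T' k k')) := by
    intro k k'
    rw [hMe]
    exact Real.convexOn_mul_log.2 (h0 k k') (h0' k k') (by norm_num) (by norm_num) (by norm_num)
  have hlt : M i j * Real.log (M i j) <
      (1 / 2 : ℝ) * (T i j * Real.log (T i j)) + (1 / 2 : ℝ) * (T' i j * Real.log (T' i j)) := by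
    rw [hMe]
    exact Real.strictConvexOn_mul_log.2 (h0 i j) (h0' i j) hij (by norm_num) (by norm_num)
      (by norm_num)
  have hsum : ∑ k, ∑ k', M k k' * Real.log (M k k') <
      ∑ k, ∑ k', ((1 / 2 : ℝ) * (T k k' * Real.log (T k k')) +
        (1 / 2 : ℝ) * (T' k k' * Real.log (T' k k'))) :=
    Finset.sum_lt_sum (fun k _ => Finset.sum_le_sum fun k' _ => hle k k')
      ⟨i, Finset.mem_univ _, Finset.sum_lt_sum (fun k' _ => hle i k') ⟨j, Finset.mem_univ _, hlt⟩⟩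
  have hlin : ∑ k, ∑ k', M k k' * (-S k k') =
      (1 / 2 : ℝ) * (∑ k, ∑ k', T k k' * (-S k k')) +
        (1 / 2 : ℝ) * (∑ k, ∑ k', T' k k' * (-S k k')) := by
    simp only [Finset.mul_sum, ← Finset.sum_add_distrib]
    refine Finset.sum_congr rfl fun k _ => Finset.sum_congr rfl fun k' _ => ?_
    rw [hMe]
    ring
  simp only [Finset.sum_add_distrib, ← Finset.mul_sum] at hsum
  have h1 := hT.2 M hMmem
  have h2 := hT'.2 M hMmem
  unfold otObjective entropy at h1 h2
  rw [hlin] at h1 h2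
  nlinarith [mul_lt_mul_of_pos_left hsum hε]

/-- The entropic optimal transport (Sinkhorn) coupling `T(ε)` of the matrix `S`. -/
def sinkhorn {K : ℕ} (ε : ℝ) (S : Matrix (Fin K) (Fin K) ℝ) : Matrix (Fin K) (Fin K) ℝ :=
  (exists_isEntropicCoupling ε S).choose

/-- The coupling of the slot configuration `(q, c)`. -/
def coupling {K D : ℕ} (ε : ℝ) (q c : Fin K → EuclideanSpace ℝ (Fin D)) :
    Matrix (Fin K) (Fin K) ℝ :=
  sinkhorn ε (simMatrix q c)

/-- The assignment score `(1/K) ∑ T k k' cos (q k, c k')` with `T = T(ε)`. -/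
def score {K D : ℕ} (ε : ℝ) (q c : Fin K → EuclideanSpace ℝ (Fin D)) : ℝ :=
  (1 / (K : ℝ)) * ∑ k, ∑ k', coupling ε q c k k' * cosSim (q k) (c k')

/-- For a unit vector `z`, the orthogonal projection `v - ⟨z, v⟩ z` onto the complement of `z`. -/
def perpProj {D : ℕ} (z v : EuclideanSpace ℝ (Fin D)) : EuclideanSpace ℝ (Fin D) :=
  v - (inner ℝ z v) • z

/-- The hard Chamfer gradient with respect to query slot `k`, with matched index `f k`. -/
def hardGrad {K D : ℕ} (q c : Fin K → EuclideanSpace ℝ (Fin D)) (f : Fin K → Fin K) (k : Fin K) :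
    EuclideanSpace ℝ (Fin D) :=
  (1 / (K : ℝ)) • perpProj (q k) (c (f k))

/-- The direct term of the gradient with respect to query slot `k`. -/
def directGrad {K D : ℕ} (ε : ℝ) (q c : Fin K → EuclideanSpace ℝ (Fin D)) (k : Fin K) :
    EuclideanSpace ℝ (Fin D) :=
  (1 / (K : ℝ)) • perpProj (q k) (∑ k', coupling ε q c k k' • c k')

/-- The entry `T j j'` of the coupling as a function of query slot `k` alone. -/
def couplingEntry {K D : ℕ} (ε : ℝ) (q c : Fin K → EuclideanSpace ℝ (Fin D)) (k j j' : Fin K)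
    (w : EuclideanSpace ℝ (Fin D)) : ℝ :=
  coupling ε (Function.update q k w) c j j'

/-- The indirect term `(1/K) ∑ (∂T j j' / ∂(q k)) cos (q j, c j')`; the gradients are
Euclidean gradients in the ambient space (they are tangent to the sphere because the cosine
similarity is invariant under scaling). -/
def indirectGrad {K D : ℕ} (ε : ℝ) (q c : Fin K → EuclideanSpace ℝ (Fin D)) (k : Fin K) :
    EuclideanSpace ℝ (Fin D) :=
  (1 / (K : ℝ)) • ∑ j, ∑ j', cosSim (q j) (c j') • gradient (couplingEntry ε q c k j j') (q k)

/-- The full gradient of the score with respect to query slot `k`. -/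
def fullGrad {K D : ℕ} (ε : ℝ) (q c : Fin K → EuclideanSpace ℝ (Fin D)) (k : Fin K) :
    EuclideanSpace ℝ (Fin D) :=
  gradient (fun w => score ε (Function.update q k w) c) (q k)

/-- The `K × D` matrix whose rows are the full gradients. -/
def jacobian {K D : ℕ} (ε : ℝ) (q c : Fin K → EuclideanSpace ℝ (Fin D)) :
    Matrix (Fin K) (Fin D) ℝ :=
  Matrix.of fun k i => fullGrad ε q c k i

/-- The unit sphere of `ℝ^D`. -/
abbrev Sph (D : ℕ) : Type :=
  Metric.sphere (0 : EuclideanSpace ℝ (Fin D)) 1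

/-- `K` unit slots as vectors of the ambient space. -/
def vecs {K D : ℕ} (z : Fin K → Sph D) : Fin K → EuclideanSpace ℝ (Fin D) :=
  fun k => (z k : EuclideanSpace ℝ (Fin D))

/-- The product of the surface measures on the space `(S^{D-1})^K × (S^{D-1})^K` of
configurations (query slots, support slots). -/
def surfaceMeasure (K D : ℕ) : Measure ((Fin K → Sph D) × (Fin K → Sph D)) :=
  (Measure.pi fun _ : Fin K => (volume : Measure (EuclideanSpace ℝ (Fin D))).toSphere).prod
    (Measure.pi fun _ : Fin K => (volume : Measure (EuclideanSpace ℝ (Fin D))).toSphere)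

end SlotMatching

end

/-!
The coupling `T(ε)` has positive entries, since moving mass `t` into an empty cell changes the
objective by `ε t log t + O(t)`. It is therefore characterized, among positive doubly stochastic
matrices, by `ε log T - S` being orthogonal to all matrices with vanishing row and column sums. On
that space the Hessian of the negative entropy is positive definite, so by the inverse function
theorem `T` is a real analytic function of `S`.

Testing optimality of `T` against a permutation matrix that wins every row by a margin `δ` shows
that `T` puts mass at most `K² exp (-δ/ε)` off the permutation: this is the concentration, and the
estimate of the direct term. Differentiating optimality shows that the derivative `DT` is
self-adjoint, so that the indirect term in slot `k` is `(1/K) Π (∑ j, X k j • c j)` with `X` the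
derivative of `T` under scaling of `S`. Testing the linearized optimality condition against `X`
itself gives `ε ∑ X² / T = ∑ X S ≤ 2 ∑ |X|` with the last sum taken off the permutation, and
Cauchy–Schwarz bounds `∑ |X|` by `2 ε⁻¹` times the mass of `T` there.

Since the gradients are analytic in the slots, the leading `K × K` minor of the Jacobian, composed
with normalization of the slots, is analytic on the connected set of nonzero slots, so its zeros
are null unless it vanishes identically; and the product of the surface measures is absolutely
continuous with respect to the image of Lebesgue measure under normalization. At `q = (e_k)`,
`c = -q` the minor is the determinant of a nonzero multiple of `1 - J`, with `J` the all-ones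
matrix, hence nonzero for `K ≥ 2`.
-/

open scoped ContDiff

noncomputable section

namespace SlotMatching

set_option maxSynthPendingDepth 3

variable {K D : ℕ} {ε δ : ℝ} {S T : Matrix (Fin K) (Fin K) ℝ}

theorem sinkhorn_spec (ε : ℝ) (S : Matrix (Fin K) (Fin K) ℝ) :
    IsEntropicCoupling ε S (sinkhorn ε S) :=
  (exists_isEntropicCoupling ε S).choose_spec

/-! ### Optimality conditions of entropic transport -/

theorem otObjective_eq_sum (ε : ℝ) (S T : Matrix (Fin K) (Fin K) ℝ) :
    otObjective ε S T = ∑ i, ∑ j, (ε * (T i j * Real.log (T i j)) - T i j * S i j) := by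
  simp only [otObjective, entropy, Finset.sum_sub_distrib, mul_neg, Finset.sum_neg_distrib,
    Finset.mul_sum]
  ring

theorem mul_log_add_sub_le_mul_log {x y : ℝ} (hx : 0 ≤ x) (hy : 0 < y) :
    x * Real.log y + (x - y) ≤ x * Real.log x := by
  rcases hx.eq_or_lt with rfl | hx
  · simp [hy.le]
  · have hlog := Real.log_le_sub_one_of_pos (div_pos hy hx)
    rw [Real.log_div hy.ne' hx.ne'] at hlog
    calc x * Real.log y + (x - y)
        = x * (Real.log y - Real.log x - (y / x - 1)) + x * Real.log x := by
          field_simp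
          ring
      _ ≤ x * Real.log x := by nlinarith

/-- The arrays whose row sums and column sums all vanish: the directions along which doubly
stochastic matrices vary. They are functions of two indices rather than matrices because matrices
carry no canonical norm. -/
def balanced (K : ℕ) : Submodule ℝ (Fin K → Fin K → ℝ) where
  carrier := {X | (∀ i, ∑ j, X i j = 0) ∧ ∀ j, ∑ i, X i j = 0}
  add_mem' := by
    rintro X Y ⟨hXrow, hXcol⟩ ⟨hYrow, hYcol⟩
    simp [Finset.sum_add_distrib, hXrow, hXcol, hYrow, hYcol]
  zero_mem' := by simp
  smul_mem' := by
    rintro a X ⟨hrow, hcol⟩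
    simp [← Finset.mul_sum, hrow, hcol]

theorem mem_balanced {X : Fin K → Fin K → ℝ} :
    X ∈ balanced K ↔ (∀ i, ∑ j, X i j = 0) ∧ ∀ j, ∑ i, X i j = 0 :=
  Iff.rfl

theorem sub_mem_balanced {T' : Matrix (Fin K) (Fin K) ℝ} (hT' : T' ∈ doublyStochastic ℝ (Fin K))
    (hT : T ∈ doublyStochastic ℝ (Fin K)) : (fun i j => T' i j - T i j) ∈ balanced K := by
  obtain ⟨-, hrow, hcol⟩ := mem_doublyStochastic_iff_sum.1 hT
  obtain ⟨-, hrow', hcol'⟩ := mem_doublyStochastic_iff_sum.1 hT'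
  simp [mem_balanced, hrow, hcol, hrow', hcol']

theorem add_mem_doublyStochastic {X : Fin K → Fin K → ℝ}
    (hT : T ∈ doublyStochastic ℝ (Fin K)) (hX : X ∈ balanced K) (hpos : ∀ i j, 0 ≤ T i j + X i j) :
    T + Matrix.of X ∈ doublyStochastic ℝ (Fin K) := by
  obtain ⟨-, hrow, hcol⟩ := mem_doublyStochastic_iff_sum.1 hT
  refine mem_doublyStochastic_iff_sum.2 ⟨hpos, fun i => ?_, fun j => ?_⟩
  · simp [Finset.sum_add_distrib, hrow, hX.1]
  · simp [Finset.sum_add_distrib, hcol, hX.2]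

theorem otObjective_segment_le (hε : 0 ≤ ε) (S : Matrix (Fin K) (Fin K) ℝ)
    {T U : Matrix (Fin K) (Fin K) ℝ} (hT : ∀ i j, 0 ≤ T i j) (hU : ∀ i j, 0 ≤ U i j)
    {i j : Fin K} (hij : T i j = 0) {t : ℝ} (ht : 0 < t) (ht1 : t ≤ 1) :
    otObjective ε S ((1 - t) • T + t • U) ≤
      (1 - t) * otObjective ε S T + t * otObjective ε S U + ε * (t * U i j * Real.log t) := by
  have entry_le (k l : Fin K) :
      ((1 - t) * T k l + t * U k l) * Real.log ((1 - t) * T k l + t * U k l) ≤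
        (1 - t) * (T k l * Real.log (T k l)) + t * (U k l * Real.log (U k l)) +
          if k = i then if l = j then t * U i j * Real.log t else 0 else 0 := by
    by_cases hk : k = i ∧ l = j
    · obtain ⟨rfl, rfl⟩ := hk
      rcases eq_or_ne (U k l) 0 with hzero | hne
      · simp [hij, hzero]
      · simp only [hij, mul_zero, zero_mul, zero_add, if_true, Real.log_mul ht.ne' hne]
        linarith
    · have hconv := Real.convexOn_mul_log.2 (hT k l) (hU k l) (sub_nonneg.2 ht1) ht.le (by ring)
      have hzero : (if k = i then if l = j then t * U i j * Real.log t else 0 else 0) = 0 := by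
        grind
      simpa only [hzero, add_zero, smul_eq_mul] using hconv
  simp only [otObjective_eq_sum]
  calc ∑ k, ∑ l, (ε * (((1 - t) • T + t • U) k l * Real.log (((1 - t) • T + t • U) k l)) -
        ((1 - t) • T + t • U) k l * S k l)
      ≤ ∑ k, ∑ l, ((1 - t) * (ε * (T k l * Real.log (T k l)) - T k l * S k l) +
          t * (ε * (U k l * Real.log (U k l)) - U k l * S k l) +
          if k = i then if l = j then ε * (t * U i j * Real.log t) else 0 else 0) := by
        refine Finset.sum_le_sum fun k _ => Finset.sum_le_sum fun l _ => ?_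
        have hscaled := mul_le_mul_of_nonneg_left (entry_le k l) hε
        simp only [mul_add, mul_ite, mul_zero] at hscaled
        simp only [Matrix.add_apply, Matrix.smul_apply, smul_eq_mul]
        linarith
    _ = _ := by simp [Finset.sum_add_distrib, ← Finset.mul_sum, -Finset.sum_sub_distrib]

theorem IsEntropicCoupling.pos (hε : 0 < ε) (hT : IsEntropicCoupling ε S T) (i j : Fin K) :
    0 < T i j := by
  have hnonneg := (mem_doublyStochastic_iff_sum.1 hT.1).1
  refine (hnonneg i j).lt_of_ne' fun hij => ?_
  let U : Matrix (Fin K) (Fin K) ℝ := (Equiv.swap i j).permMatrix ℝ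
  have hU : U ∈ doublyStochastic ℝ (Fin K) := permMatrix_mem_doublyStochastic
  have hUij : U i j = 1 := by simp [U, Equiv.Perm.permMatrix]
  have log_ge {t : ℝ} (ht : 0 < t) (ht1 : t ≤ 1) :
      (otObjective ε S T - otObjective ε S U) / ε ≤ Real.log t := by
    have hmin := hT.2 _ (convex_doublyStochastic hT.1 hU (sub_nonneg.2 ht1) ht.le (by ring))
    have hle := hmin.trans (otObjective_segment_le hε.le S hnonneg
      (mem_doublyStochastic_iff_sum.1 hU).1 hij ht ht1)
    rw [hUij] at hle
    rw [div_le_iff₀ hε]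
    nlinarith
  obtain ⟨t, hlog, ht⟩ := ((Real.tendsto_log_nhdsGT_zero.eventually_lt_atBot _).and
    (Ioc_mem_nhdsGT one_pos)).exists
  exact hlog.not_ge (log_ge ht.1 ht.2)

theorem hasDerivAt_otObjective_line (ε : ℝ) (S : Matrix (Fin K) (Fin K) ℝ)
    {T : Matrix (Fin K) (Fin K) ℝ} (hT : ∀ i j, T i j ≠ 0) (X : Fin K → Fin K → ℝ) :
    HasDerivAt (fun t : ℝ => otObjective ε S (T + Matrix.of (t • X)))
      (∑ i, ∑ j, (ε * ((Real.log (T i j) + 1) * X i j) - X i j * S i j)) 0 := by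
  simp only [otObjective_eq_sum]
  refine HasDerivAt.fun_sum fun i _ => HasDerivAt.fun_sum fun j _ => ?_
  have hline : HasDerivAt (fun t : ℝ => (T + Matrix.of (t • X)) i j) (X i j) 0 := by
    simpa using ((hasDerivAt_id (0 : ℝ)).mul_const (X i j)).const_add (T i j)
  have hmul_log := (Real.hasDerivAt_mul_log (hT i j)).comp_of_eq (0 : ℝ) hline (by simp)
  exact (hmul_log.const_mul ε).sub (hline.mul_const (S i j))

theorem IsEntropicCoupling.sum_mul_eq_zero (hε : 0 < ε) (hT : IsEntropicCoupling ε S T)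
    {X : Fin K → Fin K → ℝ} (hX : X ∈ balanced K) :
    ∑ i, ∑ j, X i j * (ε * Real.log (T i j) - S i j) = 0 := by
  have hpos := hT.pos hε
  have eventually_pos : ∀ᶠ t in 𝓝 (0 : ℝ), ∀ i j, 0 < T i j + t * X i j := by
    refine eventually_all.2 fun i => eventually_all.2 fun j => ?_
    have hcont : Continuous fun t : ℝ => T i j + t * X i j := by fun_prop
    exact hcont.continuousAt.eventually_const_lt (by simpa using hpos i j)
  have hmin : IsLocalMin (fun t : ℝ => otObjective ε S (T + Matrix.of (t • X))) 0 := by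
    filter_upwards [eventually_pos] with t ht
    rw [zero_smul, Matrix.of_zero, add_zero]
    exact hT.2 _ (add_mem_doublyStochastic hT.1 ((balanced K).smul_mem t hX) fun i j => (ht i j).le)
  have hderiv := hmin.hasDerivAt_eq_zero
    (hasDerivAt_otObjective_line ε S (fun i j => (hpos i j).ne') X)
  calc ∑ i, ∑ j, X i j * (ε * Real.log (T i j) - S i j)
      = ∑ i, ∑ j, (ε * ((Real.log (T i j) + 1) * X i j) - X i j * S i j) -
          ε * ∑ i, ∑ j, X i j := by
        simp only [Finset.mul_sum, ← Finset.sum_sub_distrib]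
        refine Finset.sum_congr rfl fun i _ => Finset.sum_congr rfl fun j _ => ?_
        ring
    _ = 0 := by simp only [hderiv, hX.1, Finset.sum_const_zero, mul_zero, sub_zero]

theorem isEntropicCoupling_of_sum_mul_eq_zero (hε : 0 ≤ ε) (hT : T ∈ doublyStochastic ℝ (Fin K))
    (hpos : ∀ i j, 0 < T i j)
    (hcrit : ∀ X ∈ balanced K, ∑ i, ∑ j, X i j * (ε * Real.log (T i j) - S i j) = 0) :
    IsEntropicCoupling ε S T := by
  refine ⟨hT, fun T' hT' => ?_⟩
  have hnonneg := (mem_doublyStochastic_iff_sum.1 hT').1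
  have hX := sub_mem_balanced hT' hT
  rw [otObjective_eq_sum, otObjective_eq_sum]
  calc ∑ i, ∑ j, (ε * (T i j * Real.log (T i j)) - T i j * S i j)
      = ∑ i, ∑ j, (ε * (T i j * Real.log (T i j)) - T i j * S i j) +
          ∑ i, ∑ j, (T' i j - T i j) * (ε * Real.log (T i j) - S i j) +
          ε * ∑ i, ∑ j, (T' i j - T i j) := by
        simp only [hcrit _ hX, hX.1, Finset.sum_const_zero, mul_zero, add_zero]
    _ ≤ ∑ i, ∑ j, (ε * (T' i j * Real.log (T' i j)) - T' i j * S i j) := by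
      simp only [Finset.mul_sum, ← Finset.sum_add_distrib]
      refine Finset.sum_le_sum fun i _ => Finset.sum_le_sum fun j _ => ?_
      have hgibbs := mul_le_mul_of_nonneg_left
        (mul_log_add_sub_le_mul_log (hnonneg i j) (hpos i j)) hε
      linarith

theorem isEntropicCoupling_iff (hε : 0 < ε) :
    IsEntropicCoupling ε S T ↔ T ∈ doublyStochastic ℝ (Fin K) ∧ (∀ i j, 0 < T i j) ∧
      ∀ X ∈ balanced K, ∑ i, ∑ j, X i j * (ε * Real.log (T i j) - S i j) = 0 :=
  ⟨fun hT => ⟨hT.1, hT.pos hε, fun _ hX => hT.sum_mul_eq_zero hε hX⟩,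
    fun ⟨hT, hpos, hcrit⟩ => isEntropicCoupling_of_sum_mul_eq_zero hε.le hT hpos hcrit⟩

/-- The Sinkhorn coupling as a map between normed spaces of arrays. -/
def sinkhornFun (ε : ℝ) (s : Fin K → Fin K → ℝ) : Fin K → Fin K → ℝ :=
  fun i j => sinkhorn ε (Matrix.of s) i j

theorem sinkhornFun_eq_iff (hε : 0 < ε) {s t : Fin K → Fin K → ℝ} :
    sinkhornFun ε s = t ↔ Matrix.of t ∈ doublyStochastic ℝ (Fin K) ∧ (∀ i j, 0 < t i j) ∧
      ∀ X ∈ balanced K, ∑ i, ∑ j, X i j * (ε * Real.log (t i j) - s i j) = 0 := by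
  have hspec := sinkhorn_spec ε (Matrix.of s)
  rw [← Matrix.of.injective.eq_iff]
  exact (eq_comm.trans ⟨fun h => h ▸ hspec, fun h => h.unique hε hspec⟩).trans
    (isEntropicCoupling_iff hε)

theorem sinkhornFun_pos (hε : 0 < ε) (s : Fin K → Fin K → ℝ) (i j : Fin K) :
    0 < sinkhornFun ε s i j :=
  (sinkhorn_spec ε (Matrix.of s)).pos hε i j

theorem sum_row_sinkhornFun (ε : ℝ) (s : Fin K → Fin K → ℝ) (i : Fin K) :
    ∑ j, sinkhornFun ε s i j = 1 :=
  (mem_doublyStochastic_iff_sum.1 (sinkhorn_spec ε (Matrix.of s)).1).2.1 i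

theorem sum_col_sinkhornFun (ε : ℝ) (s : Fin K → Fin K → ℝ) (j : Fin K) :
    ∑ i, sinkhornFun ε s i j = 1 :=
  (mem_doublyStochastic_iff_sum.1 (sinkhorn_spec ε (Matrix.of s)).1).2.2 j

theorem sum_mul_sinkhornFun_eq_zero (hε : 0 < ε) (s : Fin K → Fin K → ℝ)
    {X : Fin K → Fin K → ℝ} (hX : X ∈ balanced K) :
    ∑ i, ∑ j, X i j * (ε * Real.log (sinkhornFun ε s i j) - s i j) = 0 :=
  (sinkhorn_spec ε (Matrix.of s)).sum_mul_eq_zero hε hX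

theorem sinkhornFun_eq_exp_div (hε : 0 < ε) {s : Fin K → Fin K → ℝ} {z : ℝ}
    (hrow : ∀ i, ∑ j, Real.exp (s i j / ε) = z) (hcol : ∀ j, ∑ i, Real.exp (s i j / ε) = z)
    (i j : Fin K) : sinkhornFun ε s i j = Real.exp (s i j / ε) / z := by
  have hz : 0 < z := hrow i ▸ Finset.sum_pos (fun _ _ => Real.exp_pos _) ⟨i, Finset.mem_univ i⟩
  have hsinkhorn : sinkhornFun ε s = fun i j => Real.exp (s i j / ε) / z := by
    refine (sinkhornFun_eq_iff hε).2 ⟨mem_doublyStochastic_iff_sum.2 ⟨fun i j => ?_, fun i => ?_,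
      fun j => ?_⟩, fun i j => div_pos (Real.exp_pos _) hz, fun X hX => ?_⟩
    · exact (div_pos (Real.exp_pos _) hz).le
    · simp [← Finset.sum_div, hrow, hz.ne']
    · simp [← Finset.sum_div, hcol, hz.ne']
    · have hlog (i j : Fin K) : ε * Real.log (Real.exp (s i j / ε) / z) - s i j =
          -(ε * Real.log z) := by
        rw [Real.log_div (Real.exp_ne_zero _) hz.ne', Real.log_exp]
        field_simp
        ring
      simp only [hlog, ← Finset.sum_mul, hX.1, zero_mul, Finset.sum_const_zero]
  rw [hsinkhorn]

/-! ### Analyticity and derivative of the coupling -/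

/-- Evaluation of the `(i, j)` entry, as a continuous linear functional. -/
def entryCLM (i j : Fin K) : StrongDual ℝ (Fin K → Fin K → ℝ) :=
  (ContinuousLinearMap.proj (φ := fun _ : Fin K => ℝ) j).comp
    (ContinuousLinearMap.proj (φ := fun _ : Fin K => Fin K → ℝ) i)

@[simp]
theorem entryCLM_apply (i j : Fin K) (X : Fin K → Fin K → ℝ) : entryCLM i j X = X i j :=
  rfl

/-- The `(i, j)` entry as a functional on balanced matrices. -/
def coord (i j : Fin K) : StrongDual ℝ (balanced K) :=
  (entryCLM i j).comp (balanced K).subtypeL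

@[simp]
theorem coord_apply (i j : Fin K) (X : balanced K) : coord i j X = (X : Fin K → Fin K → ℝ) i j :=
  rfl

/-- The functional that a similarity matrix `S` induces on balanced matrices through the entrywise
pairing; the optimal coupling depends on `S` only through it. -/
def pairing (K : ℕ) : (Fin K → Fin K → ℝ) →L[ℝ] StrongDual ℝ (balanced K) :=
  ∑ i, ∑ j, (entryCLM i j).smulRight (coord i j)

theorem pairing_apply (s : Fin K → Fin K → ℝ) (X : balanced K) :
    pairing K s X = ∑ i, ∑ j, s i j * (X : Fin K → Fin K → ℝ) i j := by
  simp [pairing]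

/-- The derivative of the negative entropy `ε ∑ t log t` at `t + X`, restricted to balanced
directions; there the constant term of `log x + 1` drops out. -/
def entropyGrad (ε : ℝ) (t : Fin K → Fin K → ℝ) (X : balanced K) :
    StrongDual ℝ (balanced K) :=
  pairing K fun i j => ε * Real.log (t i j + coord i j X)

/-- The Hessian of the negative entropy `ε ∑ t log t` on balanced directions. -/
def entropyHess (ε : ℝ) (t : Fin K → Fin K → ℝ) :
    balanced K →L[ℝ] StrongDual ℝ (balanced K) :=
  ∑ i, ∑ j, (coord i j).smulRight ((ε * (t i j)⁻¹) • coord i j)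

theorem entropyHess_apply (ε : ℝ) (t : Fin K → Fin K → ℝ) (X Y : balanced K) :
    entropyHess ε t X Y =
      ∑ i, ∑ j, ε * (t i j)⁻¹ * ((X : Fin K → Fin K → ℝ) i j * (Y : Fin K → Fin K → ℝ) i j) := by
  simp [entropyHess, mul_left_comm]

theorem entropyGrad_eq_sum (ε : ℝ) (t : Fin K → Fin K → ℝ) :
    entropyGrad ε t = fun X => ∑ i, ∑ j, (ε * Real.log (t i j + coord i j X)) • coord i j := by
  ext X Y
  simp [entropyGrad, pairing_apply]

theorem contDiffAt_entropyGrad (ε : ℝ) {t : Fin K → Fin K → ℝ} (ht : ∀ i j, t i j ≠ 0) :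
    ContDiffAt ℝ ω (entropyGrad ε t) 0 := by
  rw [entropyGrad_eq_sum]
  refine ContDiffAt.sum fun i _ => ContDiffAt.sum fun j _ => ContDiffAt.smul_const ?_ _
  have hline : ContDiffAt ℝ ω (fun X : balanced K => t i j + coord i j X) 0 :=
    contDiffAt_const.add (coord i j).contDiff.contDiffAt
  exact contDiffAt_const.mul (hline.log (by simpa using ht i j))

theorem hasFDerivAt_entropyGrad (ε : ℝ) {t : Fin K → Fin K → ℝ} (ht : ∀ i j, t i j ≠ 0) :
    HasFDerivAt (entropyGrad ε t) (entropyHess ε t) 0 := by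
  rw [entropyGrad_eq_sum]
  refine HasFDerivAt.fun_sum fun i _ => HasFDerivAt.fun_sum fun j _ => ?_
  have hlog := (((coord i j).hasFDerivAt (x := 0)).const_add (t i j)).log (by simpa using ht i j)
  convert (hlog.const_mul ε).smul_const (coord i j) using 1
  ext X Y
  simp [mul_assoc, mul_left_comm]

theorem entropyHess_injective {t : Fin K → Fin K → ℝ} (hε : 0 < ε) (ht : ∀ i j, 0 < t i j) :
    Function.Injective (entropyHess ε t) := by
  refine (injective_iff_map_eq_zero _).2 fun X hX => ?_
  have hzero : ∑ i, ∑ j,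
      ε * (t i j)⁻¹ * ((X : Fin K → Fin K → ℝ) i j * (X : Fin K → Fin K → ℝ) i j) = 0 := by
    rw [← entropyHess_apply, hX, zero_apply]
  have hnonneg (i j : Fin K) :
      0 ≤ ε * (t i j)⁻¹ * ((X : Fin K → Fin K → ℝ) i j * (X : Fin K → Fin K → ℝ) i j) :=
    mul_nonneg (mul_pos hε (inv_pos.2 (ht i j))).le (mul_self_nonneg _)
  ext i j
  have hrow := (Finset.sum_eq_zero_iff_of_nonneg fun i _ =>
    Finset.sum_nonneg fun j _ => hnonneg i j).1 hzero i (Finset.mem_univ i)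
  have hentry := (Finset.sum_eq_zero_iff_of_nonneg fun j _ => hnonneg i j).1 hrow j
    (Finset.mem_univ j)
  simpa [hε.ne', (ht i j).ne'] using hentry

/-- The Hessian of the negative entropy as an isomorphism. -/
def entropyHessEquiv {t : Fin K → Fin K → ℝ} (hε : 0 < ε) (ht : ∀ i j, 0 < t i j) :
    balanced K ≃L[ℝ] StrongDual ℝ (balanced K) :=
  (LinearEquiv.ofInjectiveOfFinrankEq (entropyHess ε t).toLinearMap
    (entropyHess_injective hε ht) (by
      rw [← Subspace.dual_finrank_eq]
      exact (LinearMap.toContinuousLinearMap (𝕜 := ℝ) (E := balanced K) (F' := ℝ)).finrank_eq)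
    ).toContinuousLinearEquiv

theorem entropyGrad_eq_pairing_iff (ε : ℝ) (s t : Fin K → Fin K → ℝ) (X : balanced K) :
    entropyGrad ε t X = pairing K s ↔
      ∀ Y ∈ balanced K, ∑ i, ∑ j, Y i j * (ε * Real.log (t i j + coord i j X) - s i j) = 0 := by
  rw [entropyGrad, ← sub_eq_zero, ← map_sub, ContinuousLinearMap.ext_iff, Subtype.forall]
  refine forall₂_congr fun Y hY => ?_
  simp [pairing_apply, mul_sub, mul_comm]

theorem analyticAt_sinkhornFun (hε : 0 < ε) (s : Fin K → Fin K → ℝ) :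
    AnalyticAt ℝ (sinkhornFun ε) s := by
  obtain ⟨ht, hpos, hcrit⟩ := (sinkhornFun_eq_iff hε (s := s)).1 rfl
  set t := sinkhornFun ε s
  have hzero : entropyGrad ε t 0 = pairing K s :=
    (entropyGrad_eq_pairing_iff ε s t 0).2 (by simpa using hcrit)
  have hne (i j : Fin K) : t i j ≠ 0 := (hpos i j).ne'
  have hcont := contDiffAt_entropyGrad ε hne
  have hderiv : HasFDerivAt (entropyGrad ε t)
      (entropyHessEquiv hε hpos : balanced K →L[ℝ] StrongDual ℝ (balanced K)) 0 :=
    hasFDerivAt_entropyGrad ε hne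
  have homega : (ω : WithTop ℕ∞) ≠ 0 := by simp
  have hstrict := hcont.hasStrictFDerivAt' hderiv homega
  let inverse := hstrict.localInverse (entropyGrad ε t) (entropyHessEquiv hε hpos) 0
  have hinverse : ContDiffAt ℝ ω inverse (pairing K s) :=
    hzero ▸ hcont.to_localInverse hderiv homega
  have hpairing : Tendsto (pairing K) (𝓝 s) (𝓝 (entropyGrad ε t 0)) :=
    hzero ▸ (pairing K).continuous.tendsto s
  have hpos_near : ∀ᶠ X : balanced K in 𝓝 0, ∀ i j, 0 < t i j + coord i j X := by
    refine eventually_all.2 fun i => eventually_all.2 fun j => ?_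
    have hentry : Continuous fun X : balanced K => t i j + coord i j X := by fun_prop
    exact hentry.continuousAt.eventually_const_lt (by simpa using hpos i j)
  have hformula : (fun s' => t + (inverse (pairing K s') : Fin K → Fin K → ℝ)) =ᶠ[𝓝 s]
      sinkhornFun ε := by
    filter_upwards [hpairing.eventually hstrict.eventually_right_inverse,
      hpairing.eventually (hstrict.localInverse_tendsto.eventually hpos_near)] with s' hright hposs
    have hmem := add_mem_doublyStochastic ht (inverse (pairing K s')).2 fun i j => (hposs i j).le
    exact ((sinkhornFun_eq_iff hε).2
      ⟨hmem, hposs, (entropyGrad_eq_pairing_iff ε s' t _).1 hright⟩).symm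
  exact (contDiffAt_const.add ((balanced K).subtypeL.contDiff.contDiffAt.comp s
    (hinverse.comp s (pairing K).contDiff.contDiffAt))).analyticAt.congr hformula

theorem hasFDerivAt_sinkhornFun (hε : 0 < ε) (s : Fin K → Fin K → ℝ) :
    HasFDerivAt (sinkhornFun ε) (fderiv ℝ (sinkhornFun ε) s) s :=
  (analyticAt_sinkhornFun hε s).differentiableAt.hasFDerivAt

theorem hasDerivAt_sinkhornFun_line (hε : 0 < ε) (s Y : Fin K → Fin K → ℝ) (i j : Fin K) :
    HasDerivAt (fun x : ℝ => sinkhornFun ε (s + x • Y) i j)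
      (fderiv ℝ (sinkhornFun ε) s Y i j) 0 := by
  have hline : HasDerivAt (fun x : ℝ => s + x • Y) Y 0 := by
    simpa using ((hasDerivAt_id (0 : ℝ)).smul_const Y).const_add s
  have hcomp := HasFDerivAt.comp_hasDerivAt_of_eq (0 : ℝ) (hasFDerivAt_sinkhornFun hε s) hline
    (by simp)
  exact hasDerivAt_pi.1 (hasDerivAt_pi.1 hcomp i) j

theorem fderiv_sinkhornFun_mem_balanced (hε : 0 < ε) (s Y : Fin K → Fin K → ℝ) :
    fderiv ℝ (sinkhornFun ε) s Y ∈ balanced K := by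
  refine mem_balanced.2 ⟨fun i => ?_, fun j => ?_⟩
  · have hsum := HasDerivAt.fun_sum fun j (_ : j ∈ Finset.univ) =>
      hasDerivAt_sinkhornFun_line hε s Y i j
    simp only [sum_row_sinkhornFun] at hsum
    exact hsum.unique (hasDerivAt_const (0 : ℝ) (1 : ℝ))
  · have hsum := HasDerivAt.fun_sum fun i (_ : i ∈ Finset.univ) =>
      hasDerivAt_sinkhornFun_line hε s Y i j
    simp only [sum_col_sinkhornFun] at hsum
    exact hsum.unique (hasDerivAt_const (0 : ℝ) (1 : ℝ))

-- Differentiate the optimality condition `sum_mul_sinkhornFun_eq_zero` along `s + x • Y`.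
theorem sum_mul_fderiv_sinkhornFun (hε : 0 < ε) (s Y : Fin K → Fin K → ℝ)
    {Z : Fin K → Fin K → ℝ} (hZ : Z ∈ balanced K) :
    ∑ i, ∑ j, Z i j * (ε * (fderiv ℝ (sinkhornFun ε) s Y i j / sinkhornFun ε s i j)) =
      ∑ i, ∑ j, Z i j * Y i j := by
  have hderiv : HasDerivAt (fun x : ℝ => ∑ i, ∑ j, Z i j *
      (ε * Real.log (sinkhornFun ε (s + x • Y) i j) - (s + x • Y) i j))
      (∑ i, ∑ j, Z i j *
        (ε * (fderiv ℝ (sinkhornFun ε) s Y i j / sinkhornFun ε s i j) - Y i j)) 0 := by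
    refine HasDerivAt.fun_sum fun i _ => HasDerivAt.fun_sum fun j _ => ?_
    have hlog := (hasDerivAt_sinkhornFun_line hε s Y i j).log (sinkhornFun_pos hε _ i j).ne'
    have hline := ((hasDerivAt_id (0 : ℝ)).mul_const (Y i j)).const_add (s i j)
    simpa using ((hlog.const_mul ε).fun_sub hline).const_mul (Z i j)
  simp only [sum_mul_sinkhornFun_eq_zero hε _ hZ] at hderiv
  have hzero := hderiv.unique (hasDerivAt_const (0 : ℝ) (0 : ℝ))
  simpa only [mul_sub, Finset.sum_sub_distrib, sub_eq_zero] using hzero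

/-- The derivative of the Sinkhorn coupling when the similarities are scaled, at scale `1`. -/
def radialDeriv (ε : ℝ) (s : Fin K → Fin K → ℝ) : Fin K → Fin K → ℝ :=
  fderiv ℝ (sinkhornFun ε) s s

theorem radialDeriv_mem_balanced (hε : 0 < ε) (s : Fin K → Fin K → ℝ) :
    radialDeriv ε s ∈ balanced K :=
  fderiv_sinkhornFun_mem_balanced hε s s

-- The derivative of the coupling is self-adjoint, being the Hessian of the optimal value.
theorem sum_fderiv_sinkhornFun_mul (hε : 0 < ε) (s Y : Fin K → Fin K → ℝ) :
    ∑ i, ∑ j, fderiv ℝ (sinkhornFun ε) s Y i j * s i j =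
      ∑ i, ∑ j, radialDeriv ε s i j * Y i j := by
  rw [← sum_mul_fderiv_sinkhornFun hε s s (fderiv_sinkhornFun_mem_balanced hε s Y),
    ← sum_mul_fderiv_sinkhornFun hε s Y (radialDeriv_mem_balanced hε s)]
  refine Finset.sum_congr rfl fun i _ => Finset.sum_congr rfl fun j _ => ?_
  rw [radialDeriv]
  ring

/-! ### Gradients of the score -/

/-- The similarities as an array of functions of the slots. -/
def simFun (q c : Fin K → EuclideanSpace ℝ (Fin D)) : Fin K → Fin K → ℝ :=
  fun i j => cosSim (q i) (c j)

theorem coupling_eq_sinkhornFun (ε : ℝ) (q c : Fin K → EuclideanSpace ℝ (Fin D)) (i j : Fin K) :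
    coupling ε q c i j = sinkhornFun ε (simFun q c) i j :=
  rfl

theorem inner_perpProj (z v w : EuclideanSpace ℝ (Fin D)) :
    inner ℝ (perpProj z v) w = inner ℝ v w - inner ℝ z v * inner ℝ z w := by
  simp [perpProj, inner_sub_left, inner_smul_left]

theorem perpProj_add (z v w : EuclideanSpace ℝ (Fin D)) :
    perpProj z (v + w) = perpProj z v + perpProj z w := by
  simp only [perpProj, inner_add_right, add_smul]
  abel

theorem hasFDerivAt_cosSim {x y : EuclideanSpace ℝ (Fin D)} (hx : ‖x‖ = 1) (hy : ‖y‖ = 1) :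
    HasFDerivAt (fun w => cosSim w y) (innerSL ℝ (perpProj x y)) x := by
  have hinner : HasFDerivAt (fun w : EuclideanSpace ℝ (Fin D) => inner ℝ w y) (innerSL ℝ y) x :=
    (innerSL ℝ y).hasFDerivAt.congr_of_eventuallyEq
      (Eventually.of_forall fun w => by simp [real_inner_comm])
  have hnorm : HasFDerivAt (fun w : EuclideanSpace ℝ (Fin D) => ‖w‖) (innerSL ℝ x) x := by
    have hsqrt := (hasStrictFDerivAt_norm_sq x).hasFDerivAt.sqrt (by simp [hx])
    simp only [Real.sqrt_sq (norm_nonneg _), hx] at hsqrt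
    refine hsqrt.congr_fderiv ?_
    ext v
    simp
  have hinv := (hasDerivAt_inv (x := ‖x‖ * ‖y‖) (by simp [hx, hy])).comp_hasFDerivAt x
    (hnorm.mul_const ‖y‖)
  refine (hinner.fun_mul hinv).congr_fderiv ?_
  ext v
  simp only [innerSL_apply_apply, inner_perpProj]
  simp [hx, hy]
  ring

/-- The derivative of the similarities of unit slots with respect to query slot `k`. -/
def simDeriv (q c : Fin K → EuclideanSpace ℝ (Fin D)) (k : Fin K) :
    EuclideanSpace ℝ (Fin D) →L[ℝ] (Fin K → Fin K → ℝ) :=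
  ContinuousLinearMap.pi fun i => ContinuousLinearMap.pi fun j =>
    if i = k then innerSL ℝ (perpProj (q k) (c j)) else 0

theorem simDeriv_apply (q c : Fin K → EuclideanSpace ℝ (Fin D)) (k i j : Fin K)
    (v : EuclideanSpace ℝ (Fin D)) :
    simDeriv q c k v i j = if i = k then inner ℝ (perpProj (q k) (c j)) v else 0 := by
  by_cases h : i = k <;> simp [simDeriv, h]

theorem sum_mul_simDeriv (q c : Fin K → EuclideanSpace ℝ (Fin D)) (k : Fin K)
    (X : Fin K → Fin K → ℝ) (v : EuclideanSpace ℝ (Fin D)) :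
    ∑ i, ∑ j, X i j * simDeriv q c k v i j =
      inner ℝ (perpProj (q k) (∑ j, X k j • c j)) v := by
  calc ∑ i, ∑ j, X i j * simDeriv q c k v i j
      = ∑ j, X k j * inner ℝ (perpProj (q k) (c j)) v := by
        simp [simDeriv_apply, Finset.sum_ite_irrel]
    _ = inner ℝ (perpProj (q k) (∑ j, X k j • c j)) v := by
        simp only [inner_perpProj, sum_inner, inner_sum, real_inner_smul_left,
          real_inner_smul_right, mul_sub, Finset.sum_sub_distrib, Finset.sum_mul, mul_assoc]

section UnitSlots

variable {q c : Fin K → EuclideanSpace ℝ (Fin D)}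

theorem hasFDerivAt_simFun (hq : ∀ k, ‖q k‖ = 1) (hc : ∀ k, ‖c k‖ = 1) (k : Fin K) :
    HasFDerivAt (fun w => simFun (Function.update q k w) c) (simDeriv q c k) (q k) := by
  refine hasFDerivAt_pi.2 fun i => hasFDerivAt_pi.2 fun j => ?_
  by_cases h : i = k
  · subst h
    simpa [simFun] using hasFDerivAt_cosSim (hq i) (hc j)
  · simpa [simFun, h] using hasFDerivAt_const _ _

theorem hasFDerivAt_couplingEntry (hε : 0 < ε) (hq : ∀ k, ‖q k‖ = 1) (hc : ∀ k, ‖c k‖ = 1)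
    (k i j : Fin K) :
    HasFDerivAt (couplingEntry ε q c k i j)
      ((entryCLM i j).comp ((fderiv ℝ (sinkhornFun ε) (simFun q c)).comp (simDeriv q c k)))
      (q k) := by
  have hsinkhorn := hasFDerivAt_sinkhornFun hε (simFun (Function.update q k (q k)) c)
  have hcomp := HasFDerivAt.comp (q k) hsinkhorn (hasFDerivAt_simFun hq hc k)
  rw [Function.update_eq_self] at hcomp
  exact hasFDerivAt_pi'.1 (hasFDerivAt_pi'.1 hcomp i) j

theorem indirectGrad_eq (hε : 0 < ε) (hq : ∀ k, ‖q k‖ = 1) (hc : ∀ k, ‖c k‖ = 1) (k : Fin K) :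
    indirectGrad ε q c k =
      (1 / (K : ℝ)) • perpProj (q k) (∑ j, radialDeriv ε (simFun q c) k j • c j) := by
  refine ext_inner_right ℝ fun v => ?_
  rw [indirectGrad, real_inner_smul_left, real_inner_smul_left, ← sum_mul_simDeriv,
    ← sum_fderiv_sinkhornFun_mul hε]
  simp [sum_inner, real_inner_smul_left, inner_gradient_left,
    (hasFDerivAt_couplingEntry hε hq hc k _ _).fderiv, simFun, mul_comm]

theorem hasFDerivAt_score (hε : 0 < ε) (hq : ∀ k, ‖q k‖ = 1) (hc : ∀ k, ‖c k‖ = 1) (k : Fin K) :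
    HasFDerivAt (fun w => score ε (Function.update q k w) c)
      (innerSL ℝ (directGrad ε q c k + indirectGrad ε q c k)) (q k) := by
  have hsim (i j : Fin K) := hasFDerivAt_pi'.1 (hasFDerivAt_pi'.1 (hasFDerivAt_simFun hq hc k) i) j
  have hderiv := HasFDerivAt.const_mul (HasFDerivAt.fun_sum fun i (_ : i ∈ Finset.univ) =>
    HasFDerivAt.fun_sum fun j (_ : j ∈ Finset.univ) =>
      (hasFDerivAt_couplingEntry hε hq hc k i j).fun_mul (hsim i j)) (1 / (K : ℝ))
  refine hderiv.congr_fderiv ?_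
  ext v
  have hdirect := sum_mul_simDeriv q c k (sinkhornFun ε (simFun q c)) v
  have hindirect := sum_fderiv_sinkhornFun_mul hε (simFun q c) (simDeriv q c k v)
  rw [sum_mul_simDeriv] at hindirect
  rw [innerSL_apply_apply, inner_add_left, indirectGrad_eq hε hq hc, directGrad,
    real_inner_smul_left, real_inner_smul_left, ← mul_add, ← hindirect]
  simp only [coupling_eq_sinkhornFun, ← hdirect, ← Finset.sum_add_distrib]
  simp [couplingEntry, coupling_eq_sinkhornFun, simFun, mul_comm]

theorem fullGrad_eq_directGrad_add_indirectGrad (hε : 0 < ε) (hq : ∀ k, ‖q k‖ = 1)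
    (hc : ∀ k, ‖c k‖ = 1) (k : Fin K) :
    fullGrad ε q c k = directGrad ε q c k + indirectGrad ε q c k :=
  ext_inner_right ℝ fun v => by
    rw [fullGrad, inner_gradient_left, (hasFDerivAt_score hε hq hc k).fderiv, innerSL_apply_apply]

theorem fullGrad_eq (hε : 0 < ε) (hq : ∀ k, ‖q k‖ = 1) (hc : ∀ k, ‖c k‖ = 1) (k : Fin K) :
    fullGrad ε q c k = (1 / (K : ℝ)) • perpProj (q k)
      (∑ j, (sinkhornFun ε (simFun q c) k j + radialDeriv ε (simFun q c) k j) • c j) := by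
  rw [fullGrad_eq_directGrad_add_indirectGrad hε hq hc, directGrad, indirectGrad_eq hε hq hc,
    ← smul_add, ← perpProj_add]
  simp only [coupling_eq_sinkhornFun, ← Finset.sum_add_distrib, ← add_smul]

end UnitSlots

/-! ### Concentration on the greedy assignment -/

/-- `σ` selects in every row of `s` an entry that exceeds the others by at least `δ`. -/
def HasRowMargin (s : Fin K → Fin K → ℝ) (σ : Fin K → Fin K) (δ : ℝ) : Prop :=
  ∀ i j, j ≠ σ i → s i j + δ ≤ s i (σ i)

theorem IsRowArgmax.hasRowMargin {S : Matrix (Fin K) (Fin K) ℝ} {σ : Fin K → Fin K}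
    (hσ : IsRowArgmax S σ) (hδ : δ ≤ minGap S) : HasRowMargin S σ δ := by
  intro i j hj
  have : Nonempty (Fin K) := ⟨i⟩
  have hrow : δ ≤ rowMax S i - rowSecondMax S i :=
    hδ.trans (ciInf_le (Set.finite_range _).bddBelow i)
  have hmax : rowMax S i ≤ S i (σ i) := ciSup_le (hσ i)
  have hsecond : S i j ≤ rowSecondMax S i := by
    refine le_ciInf fun a => ?_
    have hle (k' : {k' : Fin K // k' ≠ a}) : S i k' ≤ ⨆ k' : {k' : Fin K // k' ≠ a}, S i k' :=
      le_ciSup (f := fun k' : {k' : Fin K // k' ≠ a} => S i k') (Set.finite_range _).bddAbove k'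
    by_cases ha : j = a
    · exact (hσ i j).trans (hle ⟨σ i, fun h => hj (ha.trans h.symm)⟩)
    · exact hle ⟨j, ha⟩
  linarith

/-- The index pairs off the graph of `σ`. -/
def offGraph (σ : Fin K → Fin K) : Finset (Fin K × Fin K) :=
  {p | p.2 ≠ σ p.1}

theorem sum_offGraph (σ : Fin K → Fin K) (X : Fin K → Fin K → ℝ) :
    ∑ p ∈ offGraph σ, X p.1 p.2 = ∑ i, ∑ j ∈ Finset.univ.erase (σ i), X i j :=
  Finset.sum_finset_product' _ _ _ (by simp [offGraph])

theorem sum_erase_le_sum_offGraph {X : Fin K → Fin K → ℝ} (hX : ∀ i j, 0 ≤ X i j)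
    (σ : Fin K → Fin K) (i : Fin K) :
    ∑ j ∈ Finset.univ.erase (σ i), X i j ≤ ∑ p ∈ offGraph σ, X p.1 p.2 := by
  rw [sum_offGraph]
  exact Finset.single_le_sum (f := fun i => ∑ j ∈ Finset.univ.erase (σ i), X i j)
    (fun i _ => Finset.sum_nonneg fun j _ => hX i j) (Finset.mem_univ i)

theorem sum_abs_le_of_sum_eq_zero {ι : Type*} [Fintype ι] [DecidableEq ι] {x : ι → ℝ}
    (hx : ∑ j, x j = 0) (a : ι) : ∑ j, |x j| ≤ 2 * ∑ j ∈ Finset.univ.erase a, |x j| := by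
  rw [← Finset.add_sum_erase _ _ (Finset.mem_univ a)] at hx ⊢
  have hxa : |x a| ≤ ∑ j ∈ Finset.univ.erase a, |x j| := by
    rw [eq_neg_of_add_eq_zero_left hx, abs_neg]
    exact Finset.abs_sum_le_sum_abs _ _
  linarith

theorem sum_mul_le_of_mem_balanced {X Y : Fin K → Fin K → ℝ} (hX : X ∈ balanced K)
    (hY : ∀ i j, |Y i j| ≤ 1) (σ : Fin K → Fin K) :
    ∑ i, ∑ j, X i j * Y i j ≤ 2 * ∑ p ∈ offGraph σ, |X p.1 p.2| := by
  rw [sum_offGraph σ fun i j => |X i j|, Finset.mul_sum]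
  refine Finset.sum_le_sum fun i _ => le_trans (Finset.sum_le_sum fun j _ => ?_)
    (sum_abs_le_of_sum_eq_zero ((mem_balanced.1 hX).1 i) (σ i))
  calc X i j * Y i j ≤ |X i j| * |Y i j| := (le_abs_self _).trans (abs_mul _ _).le
    _ ≤ |X i j| := mul_le_of_le_one_right (abs_nonneg _) (hY i j)

section Margin

variable {s : Fin K → Fin K → ℝ} {σ : Fin K → Fin K}

theorem sum_erase_sinkhornFun (ε : ℝ) (s : Fin K → Fin K → ℝ) (i a : Fin K) :
    ∑ j ∈ Finset.univ.erase a, sinkhornFun ε s i j = 1 - sinkhornFun ε s i a := by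
  rw [← sum_row_sinkhornFun ε s i, ← Finset.add_sum_erase _ _ (Finset.mem_univ a),
    add_sub_cancel_left]

theorem sinkhornFun_le_one (hε : 0 < ε) (s : Fin K → Fin K → ℝ) (i j : Fin K) :
    sinkhornFun ε s i j ≤ 1 := by
  rw [← sum_row_sinkhornFun ε s i]
  exact Finset.single_le_sum (f := fun j => sinkhornFun ε s i j)
    (fun j _ => (sinkhornFun_pos hε s i j).le) (Finset.mem_univ j)

theorem sum_single_sub_sinkhornFun_mul_le (hε : 0 < ε) (hmargin : HasRowMargin s σ δ)
    (i : Fin K) :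
    ∑ j, ((Pi.single (σ i) 1 : Fin K → ℝ) j - sinkhornFun ε s i j) *
        (ε * Real.log (sinkhornFun ε s i j) - s i j) ≤
      ∑ j ∈ Finset.univ.erase (σ i), ε * (Real.exp (-δ / ε) - sinkhornFun ε s i j) := by
  set t := sinkhornFun ε s
  have hentry (j : Fin K) (hj : j ≠ σ i) :
      t i j * ((ε * Real.log (t i (σ i)) - s i (σ i)) - (ε * Real.log (t i j) - s i j)) ≤
        ε * (Real.exp (-δ / ε) - t i j) := by
    have hpos : 0 < t i j := sinkhornFun_pos hε s i j
    have hlog : ε * Real.log (t i (σ i)) ≤ 0 := mul_nonpos_of_nonneg_of_nonpos hε.le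
      (Real.log_nonpos (sinkhornFun_pos hε s _ _).le (sinkhornFun_le_one hε s _ _))
    have hgibbs := mul_le_mul_of_nonneg_left
      (mul_log_add_sub_le_mul_log hpos.le (Real.exp_pos (-δ / ε))) hε.le
    calc _ ≤ t i j * (-δ - ε * Real.log (t i j)) :=
          mul_le_mul_of_nonneg_left (by linarith [hmargin i j hj]) hpos.le
      _ = ε * (t i j * (-δ / ε)) - ε * (t i j * Real.log (t i j)) := by field_simp
      _ ≤ ε * (Real.exp (-δ / ε) - t i j) := by rw [Real.log_exp] at hgibbs; linarith
  calc _ = ∑ j, t i j *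
        ((ε * Real.log (t i (σ i)) - s i (σ i)) - (ε * Real.log (t i j) - s i j)) := by
        simp only [sub_mul _ _ (ε * _ - _), mul_sub (t i _) (_ - _), Finset.sum_sub_distrib,
          ← Finset.sum_mul, t, sum_row_sinkhornFun]
        simp [Pi.single_apply]
    _ = ∑ j ∈ Finset.univ.erase (σ i), t i j *
        ((ε * Real.log (t i (σ i)) - s i (σ i)) - (ε * Real.log (t i j) - s i j)) :=
        (Finset.sum_erase _ (by simp)).symm
    _ ≤ _ := Finset.sum_le_sum fun j hj => hentry j (Finset.ne_of_mem_erase hj)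

theorem single_sub_sinkhornFun_mem_balanced (ε : ℝ) (s : Fin K → Fin K → ℝ)
    (hσ : Function.Bijective σ) :
    (fun i j => (Pi.single (σ i) 1 : Fin K → ℝ) j - sinkhornFun ε s i j) ∈ balanced K := by
  refine mem_balanced.2 ⟨fun i => ?_, fun j => ?_⟩
  · simp [sum_row_sinkhornFun]
  · obtain ⟨a, rfl⟩ := hσ.2 j
    simp [sum_col_sinkhornFun, Pi.single_apply, hσ.1.eq_iff]

theorem sum_offGraph_sinkhornFun_le (hε : 0 < ε) (hσ : Function.Bijective σ)
    (hmargin : HasRowMargin s σ δ) :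
    ∑ p ∈ offGraph σ, sinkhornFun ε s p.1 p.2 ≤ (K : ℝ) ^ 2 * Real.exp (-δ / ε) := by
  have hnonneg : 0 ≤ ε * ∑ p ∈ offGraph σ, (Real.exp (-δ / ε) - sinkhornFun ε s p.1 p.2) := by
    rw [sum_offGraph σ fun i j => Real.exp (-δ / ε) - sinkhornFun ε s i j]
    simp only [Finset.mul_sum]
    exact (sum_mul_sinkhornFun_eq_zero hε s
      (single_sub_sinkhornFun_mem_balanced ε s hσ)).symm.le.trans
        (Finset.sum_le_sum fun i _ => sum_single_sub_sinkhornFun_mul_le hε hmargin i)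
  have hcard : ((offGraph σ).card : ℝ) ≤ (K : ℝ) ^ 2 := by
    have := Finset.card_le_univ (offGraph σ)
    rw [Fintype.card_prod, Fintype.card_fin, ← sq] at this
    exact_mod_cast this
  have hsub := nonneg_of_mul_nonneg_right hnonneg hε
  rw [Finset.sum_sub_distrib, sub_nonneg, Finset.sum_const, nsmul_eq_mul] at hsub
  exact hsub.trans (mul_le_mul_of_nonneg_right hcard (Real.exp_pos _).le)

theorem one_sub_sinkhornFun_le (hε : 0 < ε) (hσ : Function.Bijective σ)
    (hmargin : HasRowMargin s σ δ) (k : Fin K) :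
    1 - sinkhornFun ε s k (σ k) ≤ (K : ℝ) ^ 2 * Real.exp (-δ / ε) := by
  rw [← sum_erase_sinkhornFun]
  exact (sum_erase_le_sum_offGraph (fun i j => (sinkhornFun_pos hε s i j).le) σ k).trans
    (sum_offGraph_sinkhornFun_le hε hσ hmargin)

-- Testing the linearized optimality condition against `X = radialDeriv ε s` itself bounds
-- `ε ∑ X² / T` by `2 ∑ |X|` off the graph; Cauchy–Schwarz turns this into a bound on `∑ |X|`.
theorem sum_offGraph_abs_radialDeriv_le (hε : 0 < ε) (hs : ∀ i j, |s i j| ≤ 1)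
    (σ : Fin K → Fin K) :
    ∑ p ∈ offGraph σ, |radialDeriv ε s p.1 p.2| ≤
      2 * ε⁻¹ * ∑ p ∈ offGraph σ, sinkhornFun ε s p.1 p.2 := by
  have hpos := sinkhornFun_pos hε s
  have hX := radialDeriv_mem_balanced hε s
  set t := sinkhornFun ε s
  set X := radialDeriv ε s
  set A := ∑ p ∈ offGraph σ, |X p.1 p.2|
  set m := ∑ p ∈ offGraph σ, t p.1 p.2
  have hquot (i j : Fin K) : 0 ≤ X i j ^ 2 / t i j := div_nonneg (sq_nonneg _) (hpos i j).le
  have henergy : ε * ∑ p ∈ offGraph σ, X p.1 p.2 ^ 2 / t p.1 p.2 ≤ 2 * A :=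
    calc ε * ∑ p ∈ offGraph σ, X p.1 p.2 ^ 2 / t p.1 p.2
        ≤ ε * ∑ p : Fin K × Fin K, X p.1 p.2 ^ 2 / t p.1 p.2 := by
          gcongr
          · exact fun _ _ _ => hquot _ _
          · exact Finset.subset_univ _
      _ = ∑ i, ∑ j, X i j * (ε * (X i j / t i j)) := by
          simp only [Fintype.sum_prod_type, Finset.mul_sum]
          exact Finset.sum_congr rfl fun i _ => Finset.sum_congr rfl fun j _ => by ring
      _ = ∑ i, ∑ j, X i j * s i j := sum_mul_fderiv_sinkhornFun hε s s hX
      _ ≤ 2 * A := sum_mul_le_of_mem_balanced hX hs σ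
  have hcauchy : A ^ 2 ≤ m * ∑ p ∈ offGraph σ, X p.1 p.2 ^ 2 / t p.1 p.2 :=
    Finset.sum_sq_le_sum_mul_sum_of_sq_le_mul _ (fun _ _ => (hpos _ _).le) (fun _ _ => hquot _ _)
      fun p _ => by rw [sq_abs, mul_div_cancel₀ _ (hpos p.1 p.2).ne']
  have hm : 0 ≤ m := Finset.sum_nonneg fun p _ => (hpos p.1 p.2).le
  have hA : 0 ≤ A := Finset.sum_nonneg fun p _ => abs_nonneg _
  rcases hA.eq_or_lt with hzero | hApos
  · rw [← hzero]
    positivity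
  · refine le_of_mul_le_mul_right ?_ hApos
    calc A * A = A ^ 2 := (sq A).symm
      _ ≤ m * (ε⁻¹ * (2 * A)) :=
        hcauchy.trans (mul_le_mul_of_nonneg_left ((le_inv_mul_iff₀ hε).2 henergy) hm)
      _ = 2 * ε⁻¹ * m * A := by ring

end Margin

theorem norm_perpProj_le {z : EuclideanSpace ℝ (Fin D)} (hz : ‖z‖ = 1)
    (v : EuclideanSpace ℝ (Fin D)) : ‖perpProj z v‖ ≤ ‖v‖ := by
  rw [perpProj, ← Submodule.starProjection_unit_singleton ℝ hz,
    ← Submodule.starProjection_orthogonal_val]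
  exact Submodule.norm_starProjection_apply_le _ v

theorem abs_simFun_le_one (q c : Fin K → EuclideanSpace ℝ (Fin D)) (i j : Fin K) :
    |simFun q c i j| ≤ 1 :=
  abs_real_inner_div_norm_mul_norm_le_one (q i) (c j)

theorem norm_smul_perpProj_sum_le {z : EuclideanSpace ℝ (Fin D)} (hz : ‖z‖ = 1)
    {c : Fin K → EuclideanSpace ℝ (Fin D)} (hc : ∀ j, ‖c j‖ = 1) {x : Fin K → ℝ}
    (hx : ∑ j, x j = 0) (a : Fin K) :
    ‖(1 / (K : ℝ)) • perpProj z (∑ j, x j • c j)‖ ≤ 2 * ∑ j ∈ Finset.univ.erase a, |x j| := by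
  have hK : ‖1 / (K : ℝ)‖ ≤ 1 := by simpa using Nat.cast_inv_le_one K
  calc ‖(1 / (K : ℝ)) • perpProj z (∑ j, x j • c j)‖ ≤ ‖perpProj z (∑ j, x j • c j)‖ := by
        rw [norm_smul]
        exact mul_le_of_le_one_left (norm_nonneg _) hK
    _ ≤ ‖∑ j, x j • c j‖ := norm_perpProj_le hz _
    _ ≤ ∑ j, |x j| := (norm_sum_le _ _).trans_eq <| by simp [norm_smul, hc]
    _ ≤ _ := sum_abs_le_of_sum_eq_zero hx a

section Bounds

variable {q c : Fin K → EuclideanSpace ℝ (Fin D)} {σ : Fin K → Fin K}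

theorem norm_directGrad_sub_hardGrad_le (hε : 0 < ε) (hq : ∀ k, ‖q k‖ = 1) (hc : ∀ k, ‖c k‖ = 1)
    (hσ : Function.Bijective σ) (hmargin : HasRowMargin (simFun q c) σ δ) (k : Fin K) :
    ‖directGrad ε q c k - hardGrad q c σ k‖ ≤ 2 * (K : ℝ) ^ 2 * Real.exp (-δ / ε) := by
  set t := sinkhornFun ε (simFun q c)
  set x : Fin K → ℝ := t k - Pi.single (σ k) 1 with hx
  have hdiff : directGrad ε q c k - hardGrad q c σ k =
      (1 / (K : ℝ)) • perpProj (q k) (∑ j, x j • c j) := by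
    rw [directGrad, hardGrad, ← smul_sub, sub_eq_iff_eq_add.2]
    have hcoupling : ∑ j, coupling ε q c k j • c j = ∑ j, x j • c j + c (σ k) := by
      simp [hx, sub_smul, Pi.single_apply, t, coupling_eq_sinkhornFun]
    rw [hcoupling, perpProj_add]
  have hsum : ∑ j, x j = 0 := by simp [hx, t, sum_row_sinkhornFun]
  have habs : ∑ j ∈ Finset.univ.erase (σ k), |x j| = 1 - t k (σ k) := by
    rw [← sum_erase_sinkhornFun]
    refine Finset.sum_congr rfl fun j hj => ?_
    rw [hx, Pi.sub_apply, Pi.single_eq_of_ne (Finset.ne_of_mem_erase hj), sub_zero,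
      abs_of_pos (sinkhornFun_pos hε _ k j)]
  calc _ ≤ 2 * (1 - t k (σ k)) := by
        rw [hdiff, ← habs]
        exact norm_smul_perpProj_sum_le (hq k) hc hsum (σ k)
    _ ≤ _ := by linarith [one_sub_sinkhornFun_le hε hσ hmargin k]

theorem norm_indirectGrad_le (hε : 0 < ε) (hq : ∀ k, ‖q k‖ = 1) (hc : ∀ k, ‖c k‖ = 1)
    (hσ : Function.Bijective σ) (hmargin : HasRowMargin (simFun q c) σ δ) (k : Fin K) :
    ‖indirectGrad ε q c k‖ ≤ 4 * (K : ℝ) ^ 2 * (ε⁻¹ * Real.exp (-δ / ε)) := by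
  set X := radialDeriv ε (simFun q c)
  have hrow := (mem_balanced.1 (radialDeriv_mem_balanced hε (simFun q c))).1 k
  rw [indirectGrad_eq hε hq hc]
  calc _ ≤ 2 * ∑ j ∈ Finset.univ.erase (σ k), |X k j| :=
        norm_smul_perpProj_sum_le (hq k) hc hrow (σ k)
    _ ≤ 2 * (2 * ε⁻¹ * ((K : ℝ) ^ 2 * Real.exp (-δ / ε))) := by
        gcongr
        exact (sum_erase_le_sum_offGraph (X := fun i j => |X i j|) (fun _ _ => abs_nonneg _)
          σ k).trans <| (sum_offGraph_abs_radialDeriv_le hε (abs_simFun_le_one q c) σ).trans <|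
            mul_le_mul_of_nonneg_left (sum_offGraph_sinkhornFun_le hε hσ hmargin) (by positivity)
    _ = _ := by ring

theorem tendsto_inv_mul_exp_neg_div (hδ : 0 < δ) :
    Tendsto (fun ε : ℝ => ε⁻¹ * Real.exp (-δ / ε)) (𝓝[>] 0) (𝓝 0) :=
  ((tendsto_rpow_mul_exp_neg_mul_atTop_nhds_zero 1 δ hδ).comp
    (tendsto_inv_nhdsGT_zero (𝕜 := ℝ))).congr fun ε => by simp [div_eq_mul_inv]

theorem tendsto_indirectGrad_zero (hδ : 0 < δ) (hq : ∀ k, ‖q k‖ = 1) (hc : ∀ k, ‖c k‖ = 1)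
    (hσ : Function.Bijective σ) (hmargin : HasRowMargin (simFun q c) σ δ) (k : Fin K) :
    Tendsto (fun ε => indirectGrad ε q c k) (𝓝[>] 0) (𝓝 0) :=
  squeeze_zero_norm' (eventually_mem_nhdsWithin.mono fun _ hε =>
    norm_indirectGrad_le hε hq hc hσ hmargin k)
    (by simpa using (tendsto_inv_mul_exp_neg_div hδ).const_mul (4 * (K : ℝ) ^ 2))

end Bounds

/-! ### Zeros of analytic functions and the surface measure -/

section AnalyticZeros

variable {E F : Type*} [NormedAddCommGroup E] [NormedSpace ℝ E]
  [NormedAddCommGroup F] [NormedSpace ℝ F] {U : Set E} {f : E → F} {p : E}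

theorem volume_line_zeros_eq_zero (hUo : IsOpen U) (hU : Convex ℝ U) (hf : AnalyticOnNhd ℝ f U)
    (hp : p ∈ U) (hfp : f p ≠ 0) (v : E) :
    volume {t : ℝ | p + t • v ∈ U ∩ f ⁻¹' {0}} = 0 := by
  have hconvex : Convex ℝ {t : ℝ | p + t • v ∈ U} := by
    have hline (t : ℝ) : AffineMap.lineMap p (p + v) t = p + t • v := by
      simp [AffineMap.lineMap_apply, add_comm]
    simpa only [Set.preimage, hline] using hU.affine_preimage (AffineMap.lineMap p (p + v))
  have hmeas : MeasurableSet {t : ℝ | p + t • v ∈ U} :=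
    (hUo.preimage (by fun_prop : Continuous fun t : ℝ => p + t • v)).measurableSet
  have hanalytic : AnalyticOnNhd ℝ (fun t : ℝ => f (p + t • v)) {t : ℝ | p + t • v ∈ U} :=
    fun t ht => AnalyticAt.fun_comp (hf _ ht) (by fun_prop)
  have hzero : (0 : ℝ) ∈ {t : ℝ | p + t • v ∈ U} := by simpa using hp
  have hae := ae_restrict_le_codiscreteWithin (μ := (volume : Measure ℝ)) hmeas
    (hanalytic.preimage_zero_mem_codiscreteWithin (by simpa using hfp) hzero
      ⟨⟨0, hzero⟩, hconvex.isPreconnected⟩)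
  rw [mem_ae_iff, Measure.restrict_apply' hmeas] at hae
  refine measure_mono_null ?_ hae
  exact fun t ht => ⟨fun hne => hne ht.2, ht.1⟩

variable [FiniteDimensional ℝ E] [MeasurableSpace E] [BorelSpace E]
  (μ : Measure E) [μ.IsAddHaarMeasure]

-- By Fubini some homothetic copy `t⁻¹ • (Z - p)` is null, and Haar measure scales by a power of
-- `t`.
theorem addHaar_eq_zero_of_ae_volume_line_eq_zero {Z : Set E} (hZ : MeasurableSet Z) (p : E)
    (h : ∀ᵐ v ∂μ, volume {t : ℝ | p + t • v ∈ Z} = 0) : μ Z = 0 := by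
  have hmeas : Measurable fun y : ℝ × E => p + y.1 • y.2 := by fun_prop
  have hnull : (volume.prod μ) ((fun y : ℝ × E => p + y.1 • y.2) ⁻¹' Z) = 0 := by
    rw [← Measure.prod_swap, Measure.map_apply measurable_swap (hmeas hZ),
      Measure.measure_prod_null (measurable_swap (hmeas hZ))]
    exact h
  have hne : ∀ᵐ t : ℝ, t ≠ 0 := by simp [ae_iff]
  obtain ⟨t, hslice, ht⟩ := ((Measure.measure_ae_null_of_prod_null hnull).and hne).exists
  have hslice : μ ((t • ·) ⁻¹' ((p + ·) ⁻¹' Z)) = 0 := hslice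
  rw [Measure.addHaar_preimage_smul μ ht, measure_preimage_add] at hslice
  simpa [ht] using hslice

theorem addHaar_zeros_eq_zero_of_convex (hUo : IsOpen U) (hU : Convex ℝ U)
    (hf : AnalyticOnNhd ℝ f U) (hp : p ∈ U) (hfp : f p ≠ 0) : μ (U ∩ f ⁻¹' {0}) = 0 := by
  have hmeas : MeasurableSet (U ∩ f ⁻¹' {0}) := by
    obtain ⟨V, hV, hVU⟩ := continuousOn_iff_isClosed.1 hf.continuousOn {0} isClosed_singleton
    rw [Set.inter_comm, hVU]
    exact hV.measurableSet.inter hUo.measurableSet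
  exact addHaar_eq_zero_of_ae_volume_line_eq_zero μ hmeas p
    (Eventually.of_forall (volume_line_zeros_eq_zero hUo hU hf hp hfp))

theorem addHaar_zeros_eq_zero (hUo : IsOpen U) (hU : IsPreconnected U)
    (hf : AnalyticOnNhd ℝ f U) (hp : p ∈ U) (hfp : f p ≠ 0) : μ (U ∩ f ⁻¹' {0}) = 0 := by
  refine measure_null_of_locally_null _ fun x ⟨hxU, _⟩ => ?_
  obtain ⟨r, hr, hball⟩ := Metric.isOpen_iff.1 hUo x hxU
  obtain ⟨y, hy, hfy⟩ : ∃ y ∈ Metric.ball x r, f y ≠ 0 := by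
    by_contra! hzero
    exact hfp (hf.eqOn_zero_of_preconnected_of_eventuallyEq_zero hU hxU
      (eventually_of_mem (Metric.ball_mem_nhds x hr) hzero) hp)
  refine ⟨Metric.ball x r ∩ f ⁻¹' {0}, ?_, addHaar_zeros_eq_zero_of_convex μ Metric.isOpen_ball
    (convex_ball x r) (hf.mono hball) hy hfy⟩
  filter_upwards [mem_nhdsWithin_of_mem_nhds (Metric.ball_mem_nhds x hr), self_mem_nhdsWithin]
    with z hz hzU using ⟨hz, hzU.2⟩

end AnalyticZeros

section Direction

variable {E : Type*} [NormedAddCommGroup E] [NormedSpace ℝ E]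

open scoped Classical in
/-- The direction of a vector, as a point of the unit sphere; `e` is the value at zero. -/
def direction (e : Metric.sphere (0 : E) 1) (x : E) : Metric.sphere (0 : E) 1 :=
  if h : x = 0 then e else ⟨‖x‖⁻¹ • x, by simp [norm_smul, h]⟩

variable (e : Metric.sphere (0 : E) 1)

theorem coe_direction {x : E} (hx : x ≠ 0) : (direction e x : E) = ‖x‖⁻¹ • x := by
  simp [direction, hx]

theorem direction_smul_coe {r : ℝ} (hr : 0 < r) (y : Metric.sphere (0 : E) 1) :
    direction e (r • (y : E)) = y := by
  have hne : r • (y : E) ≠ 0 := smul_ne_zero hr.ne' (ne_zero_of_mem_unit_sphere y)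
  exact Subtype.ext (by simp [coe_direction e hne, norm_smul, smul_smul, abs_of_pos hr, hr.ne'])

open scoped Pointwise in
theorem Ioo_smul_image_coe (s : Set (Metric.sphere (0 : E) 1)) :
    Set.Ioo (0 : ℝ) 1 • ((↑) '' s : Set E) =
      (direction e ⁻¹' s ∩ Metric.ball 0 1) \ {0} := by
  ext x
  constructor
  · rintro ⟨r, hr, -, ⟨y, hy, rfl⟩, rfl⟩
    refine ⟨⟨?_, ?_⟩, smul_ne_zero hr.1.ne' (ne_zero_of_mem_unit_sphere y)⟩
    · simpa only [Set.mem_preimage, direction_smul_coe e hr.1] using hy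
    · simp [norm_smul, abs_of_pos hr.1, hr.2]
  · rintro ⟨⟨hx, hball⟩, hne : x ≠ 0⟩
    refine ⟨‖x‖, ⟨norm_pos_iff.2 hne, by simpa using hball⟩, _, ⟨_, hx, rfl⟩, ?_⟩
    simp [coe_direction e hne, smul_smul, hne]

variable [MeasurableSpace E] [BorelSpace E]

theorem measurable_direction : Measurable (direction e) := by
  classical
  have hcoe : (fun x => (direction e x : E)) = fun x => if x = 0 then (e : E) else ‖x‖⁻¹ • x := by
    funext x
    by_cases hx : x = 0 <;> simp [direction, hx]
  have hmeas : Measurable fun x => (direction e x : E) := by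
    rw [hcoe]
    exact Measurable.ite (measurableSet_singleton 0) measurable_const (by fun_prop)
  exact hmeas.subtype_mk (h := fun x => (direction e x).2)

theorem toSphere_eq_map_direction [FiniteDimensional ℝ E] (μ : Measure E) [μ.IsAddHaarMeasure] :
    μ.toSphere = (((Module.finrank ℝ E : ENNReal) • μ).restrict (Metric.ball 0 1)).map
      (direction e) := by
  have : Nontrivial E := ⟨e, 0, ne_zero_of_mem_unit_sphere e⟩
  ext s hs
  rw [Measure.toSphere_apply' _ hs, Measure.map_apply (measurable_direction e) hs,
    Measure.restrict_apply (measurable_direction e hs), Measure.smul_apply, smul_eq_mul,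
    Ioo_smul_image_coe e, measure_sdiff_null (measure_singleton _)]

end Direction

/-! ### Generic rank of the Jacobian -/

/-- Pairs of families of query and support slots, not necessarily of unit length. -/
abbrev Config (K D : ℕ) : Type :=
  (Fin K → EuclideanSpace ℝ (Fin D)) × (Fin K → EuclideanSpace ℝ (Fin D))

/-- The configurations all of whose slots are nonzero: the domain on which the cosine similarities
are analytic. -/
def nonzeroSlots (K D : ℕ) : Set (Config K D) :=
  (Set.univ.pi fun _ => {0}ᶜ) ×ˢ (Set.univ.pi fun _ => {0}ᶜ)

theorem mem_nonzeroSlots {x : Config K D} :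
    x ∈ nonzeroSlots K D ↔ (∀ k, x.1 k ≠ 0) ∧ ∀ k, x.2 k ≠ 0 := by
  simp [nonzeroSlots]

theorem isOpen_nonzeroSlots : IsOpen (nonzeroSlots K D) :=
  have hpi : IsOpen (Set.univ.pi fun _ : Fin K => ({0}ᶜ : Set (EuclideanSpace ℝ (Fin D)))) :=
    isOpen_set_pi Set.finite_univ fun _ _ => isOpen_compl_singleton
  hpi.prod hpi

theorem isPreconnected_nonzeroSlots (hD : 2 ≤ D) : IsPreconnected (nonzeroSlots K D) :=
  have hrank : 1 < Module.rank ℝ (EuclideanSpace ℝ (Fin D)) := by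
    rw [← Module.finrank_eq_rank, finrank_euclideanSpace_fin]
    exact_mod_cast hD
  have hcompl := (isConnected_compl_singleton_of_one_lt_rank hrank 0).isPreconnected
  have hpi := isPreconnected_univ_pi fun _ : Fin K => hcompl
  hpi.prod hpi

theorem ae_mem_nonzeroSlots (hD : 0 < D) (μ : Measure (Config K D)) [μ.IsAddHaarMeasure] :
    ∀ᵐ x ∂μ, x ∈ nonzeroSlots K D := by
  have : Nonempty (Fin D) := ⟨⟨0, hD⟩⟩
  obtain ⟨w, hw⟩ := exists_ne (0 : EuclideanSpace ℝ (Fin D))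
  have hne (L : Config K D →L[ℝ] EuclideanSpace ℝ (Fin D)) {p : Config K D} (hp : L p = w) :
      ∀ᵐ x ∂μ, L x ≠ 0 := by
    simpa [ae_iff, Set.preimage] using addHaar_zeros_eq_zero μ isOpen_univ isPreconnected_univ
      (L.analyticOnNhd _) (Set.mem_univ p) (hp ▸ hw)
  have hquery (k : Fin K) : ∀ᵐ x ∂μ, x.1 k ≠ 0 :=
    hne ((ContinuousLinearMap.proj k).comp (ContinuousLinearMap.fst ℝ _ _))
      (p := (fun _ => w, 0)) rfl
  have hsupport (k : Fin K) : ∀ᵐ x ∂μ, x.2 k ≠ 0 :=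
    hne ((ContinuousLinearMap.proj k).comp (ContinuousLinearMap.snd ℝ _ _))
      (p := (0, fun _ => w)) rfl
  filter_upwards [ae_all_iff.2 hquery, ae_all_iff.2 hsupport] with x hq hc
    using mem_nonzeroSlots.2 ⟨hq, hc⟩

theorem contDiffAt_score (hε : 0 < ε) {x : Config K D} (hx : x ∈ nonzeroSlots K D) :
    ContDiffAt ℝ ω (fun y : Config K D => score ε y.1 y.2) x := by
  obtain ⟨hq, hc⟩ := mem_nonzeroSlots.1 hx
  have hsim (i j : Fin K) : ContDiffAt ℝ ω (fun y : Config K D => cosSim (y.1 i) (y.2 j)) x := by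
    have hquery : ContDiffAt ℝ ω (fun y : Config K D => y.1 i) x := by fun_prop
    have hsupport : ContDiffAt ℝ ω (fun y : Config K D => y.2 j) x := by fun_prop
    exact (hquery.inner ℝ hsupport).div ((hquery.norm ℝ (hq i)).mul (hsupport.norm ℝ (hc j)))
      (mul_ne_zero (norm_ne_zero_iff.2 (hq i)) (norm_ne_zero_iff.2 (hc j)))
  have hcoupling : ContDiffAt ℝ ω (fun y : Config K D => sinkhornFun ε (simFun y.1 y.2)) x :=
    (analyticAt_sinkhornFun hε _).contDiffAt.comp x
      (contDiffAt_pi.2 fun i => contDiffAt_pi.2 fun j => hsim i j)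
  exact contDiffAt_const.mul (ContDiffAt.sum fun i _ => ContDiffAt.sum fun j _ =>
    (contDiffAt_pi.1 (contDiffAt_pi.1 hcoupling i) j).mul (hsim i j))

theorem fullGrad_apply_eq_fderiv (hε : 0 < ε) {x : Config K D} (hx : x ∈ nonzeroSlots K D)
    (k : Fin K) (i : Fin D) :
    fullGrad ε x.1 x.2 k i = fderiv ℝ (fun y : Config K D => score ε y.1 y.2) x
      (Pi.single k (EuclideanSpace.single i 1), 0) := by
  have hscore := ((contDiffAt_score hε hx).differentiableAt (by simp)).hasFDerivAt
  rw [← Prod.mk.eta (p := x), ← Function.update_eq_self k x.1] at hscore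
  have hupdate : HasFDerivAt (fun w => (Function.update x.1 k w, x.2)) _ (x.1 k) :=
    (hasFDerivAt_update (𝕜 := ℝ) x.1 (x.1 k)).prodMk (hasFDerivAt_const x.2 (x.1 k))
  have hcomp := HasFDerivAt.comp (x.1 k) hscore hupdate
  have hentry : fullGrad ε x.1 x.2 k i =
      inner ℝ (fullGrad ε x.1 x.2 k) (EuclideanSpace.single i (1 : ℝ)) := by
    simp [EuclideanSpace.inner_single_right]
  rw [hentry, fullGrad, inner_gradient_left]
  refine (congrArg (· (EuclideanSpace.single i (1 : ℝ))) hcomp.fderiv).trans ?_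
  rw [Function.update_eq_self]
  refine congrArg (fderiv ℝ _ x) (Prod.ext (funext fun j => ?_) rfl)
  by_cases hj : j = k
  · subst hj
    simp
  · simp [hj]

theorem analyticAt_jacobian (hε : 0 < ε) {x : Config K D} (hx : x ∈ nonzeroSlots K D)
    (k : Fin K) (i : Fin D) :
    AnalyticAt ℝ (fun y : Config K D => jacobian ε y.1 y.2 k i) x := by
  have happly := ((ContinuousLinearMap.apply ℝ ℝ
    ((Pi.single k (EuclideanSpace.single i 1), 0) : Config K D)).analyticAt _).comp
      (contDiffAt_score hε hx).analyticAt.fderiv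
  refine happly.congr ?_
  filter_upwards [isOpen_nonzeroSlots.mem_nhds hx] with y hy
    using (fullGrad_apply_eq_fderiv hε hy k i).symm

/-- The leading `K × K` minor of the Jacobian. -/
def leadingMinor (hD : K ≤ D) (ε : ℝ) (x : Config K D) : ℝ :=
  ((jacobian ε x.1 x.2).submatrix id (Fin.castLE hD)).det

theorem analyticAt_leadingMinor (hD : K ≤ D) (hε : 0 < ε) {x : Config K D}
    (hx : x ∈ nonzeroSlots K D) : AnalyticAt ℝ (leadingMinor hD ε) x := by
  rw [show leadingMinor hD ε = _ from funext fun y => Matrix.det_apply' _]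
  exact Finset.analyticAt_fun_sum _ fun τ _ => analyticAt_const.mul
    (Finset.analyticAt_fun_prod _ fun k _ => analyticAt_jacobian hε hx _ _)

theorem leadingMinor_eq_zero_of_rank_lt (hD : K ≤ D) {x : Config K D}
    (h : (jacobian ε x.1 x.2).rank < K) : leadingMinor hD ε x = 0 := by
  by_contra hne
  have hrank := Matrix.rank_submatrix_le (jacobian ε x.1 x.2) id (Fin.castLE hD)
  rw [Matrix.rank_of_isUnit _ ((Matrix.isUnit_iff_isUnit_det _).2 (isUnit_iff_ne_zero.2 hne)),
    Fintype.card_fin] at hrank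
  exact absurd h hrank.not_gt

/-- Scale every slot to unit length. -/
def normalizeSlots (x : Config K D) : Config K D :=
  (fun k => ‖x.1 k‖⁻¹ • x.1 k, fun k => ‖x.2 k‖⁻¹ • x.2 k)

theorem normalizeSlots_mem {x : Config K D} (hx : x ∈ nonzeroSlots K D) :
    normalizeSlots x ∈ nonzeroSlots K D := by
  simpa [mem_nonzeroSlots, normalizeSlots] using hx

theorem normalizeSlots_eq_self {x : Config K D} (hq : ∀ k, ‖x.1 k‖ = 1) (hc : ∀ k, ‖x.2 k‖ = 1) :
    normalizeSlots x = x := by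
  simp [normalizeSlots, hq, hc]

theorem analyticAt_normalizeSlots {x : Config K D} (hx : x ∈ nonzeroSlots K D) :
    AnalyticAt ℝ normalizeSlots x := by
  obtain ⟨hq, hc⟩ := mem_nonzeroSlots.1 hx
  have hquery (k : Fin K) : ContDiffAt ℝ ω (fun y : Config K D => y.1 k) x := by fun_prop
  have hsupport (k : Fin K) : ContDiffAt ℝ ω (fun y : Config K D => y.2 k) x := by fun_prop
  refine (ContDiffAt.prodMk (contDiffAt_pi.2 fun k => ?_)
    (contDiffAt_pi.2 fun k => ?_)).analyticAt
  · exact (((hquery k).norm ℝ (hq k)).inv (norm_ne_zero_iff.2 (hq k))).smul (hquery k)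
  · exact (((hsupport k).norm ℝ (hc k)).inv (norm_ne_zero_iff.2 (hc k))).smul (hsupport k)

theorem ae_leadingMinor_normalizeSlots_ne_zero (hD : K ≤ D) (hD' : 2 ≤ D) (hε : 0 < ε)
    (μ : Measure (Config K D)) [μ.IsAddHaarMeasure] {p : Config K D} (hq : ∀ k, ‖p.1 k‖ = 1)
    (hc : ∀ k, ‖p.2 k‖ = 1) (hp : leadingMinor hD ε p ≠ 0) :
    ∀ᵐ x ∂μ, leadingMinor hD ε (normalizeSlots x) ≠ 0 := by
  have hpmem : p ∈ nonzeroSlots K D := mem_nonzeroSlots.2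
    ⟨fun k => norm_ne_zero_iff.1 (by simp [hq]), fun k => norm_ne_zero_iff.1 (by simp [hc])⟩
  have hanalytic : AnalyticOnNhd ℝ (fun x => leadingMinor hD ε (normalizeSlots x))
      (nonzeroSlots K D) := fun x hx =>
    (analyticAt_leadingMinor hD hε (normalizeSlots_mem hx)).fun_comp (analyticAt_normalizeSlots hx)
  have hnull := addHaar_zeros_eq_zero μ isOpen_nonzeroSlots (isPreconnected_nonzeroSlots hD')
    hanalytic hpmem (by rwa [normalizeSlots_eq_self hq hc])
  filter_upwards [ae_mem_nonzeroSlots (by omega) μ, measure_eq_zero_iff_ae_notMem.1 hnull]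
    with x hx hzero hminor using hzero ⟨hx, hminor⟩

/-- The directions of all slots. -/
def slotDirections (e : Sph D) (x : Config K D) : (Fin K → Sph D) × (Fin K → Sph D) :=
  (fun k => direction e (x.1 k), fun k => direction e (x.2 k))

theorem vecs_slotDirections (e : Sph D) {x : Config K D} (hx : x ∈ nonzeroSlots K D) :
    (vecs (slotDirections e x).1, vecs (slotDirections e x).2) = normalizeSlots x :=
  Prod.ext (funext fun k => coe_direction e ((mem_nonzeroSlots.1 hx).1 k))
    (funext fun k => coe_direction e ((mem_nonzeroSlots.1 hx).2 k))

theorem measurable_slotDirections (e : Sph D) :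
    Measurable (slotDirections e : Config K D → _) := by
  have := measurable_direction e
  unfold slotDirections
  fun_prop

theorem surfaceMeasure_absolutelyContinuous_map (hD : 0 < D) (e : Sph D)
    (μ : Measure (Config K D)) [μ.IsAddHaarMeasure] :
    surfaceMeasure K D ≪ μ.map (slotDirections e) := by
  set ν : Measure (EuclideanSpace ℝ (Fin D)) :=
    (Module.finrank ℝ (EuclideanSpace ℝ (Fin D)) : ENNReal) • volume
  have : ν.IsAddHaarMeasure := Measure.IsAddHaarMeasure.smul _ (by simpa using hD.ne') (by simp)
  set ρ : Measure (Fin K → EuclideanSpace ℝ (Fin D)) := Measure.pi fun _ => ν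
  have : ρ.IsAddHaarMeasure := inferInstanceAs (Measure.pi fun _ => ν).IsAddHaarMeasure
  have hdir : Measurable fun (x : Fin K → EuclideanSpace ℝ (Fin D)) k => direction e (x k) :=
    measurable_pi_lambda _ fun k => (measurable_direction e).comp (measurable_pi_apply k)
  have hsphere : (volume : Measure (EuclideanSpace ℝ (Fin D))).toSphere =
      (ν.restrict (Metric.ball 0 1)).map (direction e) := toSphere_eq_map_direction e volume
  have : IsFiniteMeasure ((ν.restrict (Metric.ball 0 1)).map (direction e)) :=
    hsphere ▸ inferInstance
  have hpi : (Measure.pi fun _ : Fin K =>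
      (volume : Measure (EuclideanSpace ℝ (Fin D))).toSphere) =
      (ρ.restrict (Set.univ.pi fun _ => Metric.ball 0 1)).map
        fun x k => direction e (x k) := by
    rw [hsphere, Measure.restrict_pi_pi,
      Measure.pi_map_pi fun _ => (measurable_direction e).aemeasurable]
  have : (ρ.prod ρ).IsAddHaarMeasure := Measure.prod.instIsAddHaarMeasure ρ ρ
  have hρμ : ρ.prod ρ ≪ μ := Measure.absolutelyContinuous_isAddHaarMeasure _ _
  rw [surfaceMeasure, hpi, Measure.map_prod_map _ _ hdir hdir]
  refine Measure.AbsolutelyContinuous.map ?_ (measurable_slotDirections e)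
  exact (Measure.AbsolutelyContinuous.prod Measure.restrict_le_self.absolutelyContinuous
    Measure.restrict_le_self.absolutelyContinuous).trans hρμ

theorem measurableSet_leadingMinor_eq_zero (hD : K ≤ D) (hε : 0 < ε) :
    MeasurableSet {z : (Fin K → Sph D) × (Fin K → Sph D) |
      leadingMinor hD ε (vecs z.1, vecs z.2) = 0} := by
  have hvecs : Continuous fun z : (Fin K → Sph D) × (Fin K → Sph D) => (vecs z.1, vecs z.2) := by
    unfold vecs
    fun_prop
  refine (isClosed_eq (continuous_iff_continuousAt.2 fun z => ?_) continuous_const).measurableSet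
  have hz : (vecs z.1, vecs z.2) ∈ nonzeroSlots K D := mem_nonzeroSlots.2
    ⟨fun k => ne_zero_of_mem_unit_sphere (z.1 k), fun k => ne_zero_of_mem_unit_sphere (z.2 k)⟩
  exact (analyticAt_leadingMinor hD hε hz).continuousAt.comp_of_eq hvecs.continuousAt rfl

theorem surfaceMeasure_leadingMinor_eq_zero (hD : K ≤ D) (hD' : 2 ≤ D) (hε : 0 < ε)
    {p : Config K D} (hq : ∀ k, ‖p.1 k‖ = 1) (hc : ∀ k, ‖p.2 k‖ = 1)
    (hp : leadingMinor hD ε p ≠ 0) :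
    surfaceMeasure K D {z | leadingMinor hD ε (vecs z.1, vecs z.2) = 0} = 0 := by
  let e : Sph D := ⟨EuclideanSpace.single ⟨0, by omega⟩ 1, by simp⟩
  let μ : Measure (Config K D) := Measure.addHaar
  refine surfaceMeasure_absolutelyContinuous_map (by omega) e μ ?_
  rw [Measure.map_apply (measurable_slotDirections e) (measurableSet_leadingMinor_eq_zero hD hε),
    measure_eq_zero_iff_ae_notMem]
  filter_upwards [ae_mem_nonzeroSlots (by omega) μ,
    ae_leadingMinor_normalizeSlots_ne_zero hD hD' hε μ hq hc hp] with x hx hminor hzero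
  exact hminor (vecs_slotDirections e hx ▸ hzero)

theorem sum_exp_single_div (ε r : ℝ) (i : Fin K) :
    ∑ j, Real.exp ((Pi.single i r : Fin K → ℝ) j / ε) = Real.exp (r / ε) + (K - 1) := by
  rw [Fintype.sum_eq_add_sum_compl i, Finset.sum_congr rfl (g := fun _ => (1 : ℝ))]
  · simp [Finset.card_compl, Nat.cast_sub (Nat.one_le_of_lt i.pos)]
  · intro j hj
    have hji : j ≠ i := by simpa using hj
    simp [hji]

theorem sinkhornFun_single_of_ne (hε : 0 < ε) (r : ℝ) {i j : Fin K} (hij : i ≠ j) :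
    sinkhornFun ε (fun i => Pi.single i r) i j = (Real.exp (r / ε) + (K - 1))⁻¹ := by
  have hcol (j : Fin K) : ∑ i, Real.exp ((Pi.single i r : Fin K → ℝ) j / ε) =
      Real.exp (r / ε) + (K - 1) := by
    simp only [Pi.single_comm, sum_exp_single_div]
  simp [sinkhornFun_eq_exp_div hε (sum_exp_single_div ε r) hcol, hij.symm]

theorem radialDeriv_single_of_ne (hε : 0 < ε) (r : ℝ) {i j : Fin K} (hij : i ≠ j) :
    radialDeriv ε (fun i => Pi.single i r) i j =
      -(r / ε * Real.exp (r / ε)) / (Real.exp (r / ε) + (K - 1)) ^ 2 := by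
  set s : Fin K → Fin K → ℝ := fun i => Pi.single i r with hs
  have hline (x : ℝ) : sinkhornFun ε (s + x • s) i j =
      (Real.exp ((1 + x) * r / ε) + (K - 1))⁻¹ := by
    have hscale : s + x • s = fun i => Pi.single i ((1 + x) * r) := by
      ext k l
      by_cases hkl : l = k
      · subst hkl
        simp [hs, add_mul]
      · simp [hs, hkl]
    rw [hscale, sinkhornFun_single_of_ne hε _ hij]
  have hderiv := hasDerivAt_sinkhornFun_line hε s s i j
  simp only [hline] at hderiv
  have hexp : HasDerivAt (fun x : ℝ => Real.exp ((1 + x) * r / ε) + (K - 1))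
      (r / ε * Real.exp (r / ε)) 0 := by
    have hlin : HasDerivAt (fun x : ℝ => (1 + x) * r / ε) (r / ε) 0 := by
      simpa using (((hasDerivAt_id (0 : ℝ)).const_add 1).mul_const r).div_const ε
    simpa [mul_comm] using hlin.exp.add_const ((K : ℝ) - 1)
  have hK : (1 : ℝ) ≤ K := by exact_mod_cast i.pos
  have hne : Real.exp ((1 + 0) * r / ε) + (K - 1) ≠ 0 := by positivity
  simpa [radialDeriv] using hderiv.unique (hexp.fun_inv hne)

/-- Query slots along the first `K` coordinate axes. With the antipodal support slots they form
the configuration at which the leading minor is computed explicitly. -/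
def axisSlots (hD : K ≤ D) (k : Fin K) : EuclideanSpace ℝ (Fin D) :=
  EuclideanSpace.single (Fin.castLE hD k) 1

theorem norm_axisSlots (hD : K ≤ D) (k : Fin K) : ‖axisSlots hD k‖ = 1 := by
  simp [axisSlots]

theorem inner_axisSlots (hD : K ≤ D) (k : Fin K) (v : EuclideanSpace ℝ (Fin D)) :
    inner ℝ (axisSlots hD k) v = v (Fin.castLE hD k) := by
  simp [axisSlots, EuclideanSpace.inner_single_left]

theorem axisSlots_castLE (hD : K ≤ D) (k l : Fin K) :
    axisSlots hD k (Fin.castLE hD l) = if k = l then 1 else 0 := by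
  simp [axisSlots, eq_comm]

theorem simFun_axisSlots_neg (hD : K ≤ D) :
    simFun (axisSlots hD) (-axisSlots hD) = fun i => Pi.single i (-1) := by
  ext i j
  by_cases hij : i = j
  · simp [hij, simFun, cosSim, norm_axisSlots]
  · simp [Ne.symm hij, simFun, cosSim, norm_axisSlots, inner_axisSlots, axisSlots_castLE]

theorem fullGrad_axisSlots_neg_castLE (hD : K ≤ D) (hε : 0 < ε) (k l : Fin K) :
    fullGrad ε (axisSlots hD) (-axisSlots hD) k (Fin.castLE hD l) =
      if k = l then 0 else -(1 / (K : ℝ) * (sinkhornFun ε (fun i => Pi.single i (-1)) k l +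
        radialDeriv ε (fun i => Pi.single i (-1)) k l)) := by
  rw [fullGrad_eq hε (norm_axisSlots hD) fun k => by simp [norm_axisSlots], simFun_axisSlots_neg]
  by_cases hkl : k = l
  · simp [hkl, perpProj, inner_axisSlots, axisSlots_castLE]
  · simp [hkl, perpProj, inner_axisSlots, axisSlots_castLE]
    ring

theorem leadingMinor_axisSlots_ne_zero (hK : 2 ≤ K) (hD : K ≤ D) (hε : 0 < ε) :
    leadingMinor hD ε (axisSlots hD, -axisSlots hD) ≠ 0 := by
  set w := Real.exp (-1 / ε)
  set y := (w + (K - 1))⁻¹ + 1 / ε * w / (w + (K - 1)) ^ 2 with hy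
  have hK' : (2 : ℝ) ≤ K := by exact_mod_cast hK
  have hy_pos : 0 < y := by
    have hw_pos : 0 < w := Real.exp_pos _
    have hden : 0 < w + (K - 1) := by linarith
    positivity
  have hminor : (jacobian ε (axisSlots hD) (-axisSlots hD)).submatrix id (Fin.castLE hD) =
      (1 / (K : ℝ) * y) • (1 + Matrix.replicateCol Unit (fun _ : Fin K => (-1 : ℝ)) *
        Matrix.replicateRow Unit fun _ => (1 : ℝ)) := by
    ext k l
    rw [Matrix.submatrix_apply, jacobian, Matrix.of_apply, id, fullGrad_axisSlots_neg_castLE hD hε]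
    by_cases hkl : k = l
    · simp [hkl, Matrix.mul_apply]
    · rw [sinkhornFun_single_of_ne hε _ hkl, radialDeriv_single_of_ne hε _ hkl]
      have hentry : -(1 / (K : ℝ) * ((w + (K - 1))⁻¹ +
          -(-1 / ε * w) / (w + (K - 1)) ^ 2)) = -(1 / (K : ℝ) * y) := by
        rw [hy]
        ring
      simpa [hkl, Matrix.mul_apply] using hentry
  rw [leadingMinor, hminor, Matrix.det_smul, Matrix.det_one_add_replicateCol_mul_replicateRow]
  have hdot : 1 + (fun _ : Fin K => (1 : ℝ)) ⬝ᵥ (fun _ => -1) = 1 - K := by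
    simp [dotProduct, sub_eq_add_neg]
  rw [hdot]
  exact mul_ne_zero (by positivity) (by linarith)

theorem surfaceMeasure_rank_lt_eq_zero (hK : 2 ≤ K) (hD : K ≤ D) (hε : 0 < ε) :
    surfaceMeasure K D {z | (jacobian ε (vecs z.1) (vecs z.2)).rank < K} = 0 :=
  measure_mono_null
    (fun z hz => leadingMinor_eq_zero_of_rank_lt (x := (vecs z.1, vecs z.2)) hD hz)
    (surfaceMeasure_leadingMinor_eq_zero (p := (axisSlots hD, -axisSlots hD)) hD (hK.trans hD) hε
      (norm_axisSlots hD) (fun k => by simp [norm_axisSlots])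
      (leadingMinor_axisSlots_ne_zero hK hD hε))

end SlotMatching

end

open SlotMatching in
theorem mainTheorem7_general {K D : ℕ} (hK : 2 ≤ K) :
    (∀ δ : ℝ, 0 < δ → ∀ (zq zc : Fin K → Sph D) (kstar : Fin K → Fin K),
      δ ≤ minGap (simMatrix (vecs zq) (vecs zc)) →
      IsRowArgmax (simMatrix (vecs zq) (vecs zc)) kstar → Function.Bijective kstar →
      ∀ k : Fin K,
        (∀ ε : ℝ, 0 < ε →
          1 - 4 * (K : ℝ) ^ 2 * Real.exp (-δ / ε) ≤ coupling ε (vecs zq) (vecs zc) k (kstar k) ∧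
          ‖directGrad ε (vecs zq) (vecs zc) k - hardGrad (vecs zq) (vecs zc) kstar k‖ ≤
            4 * (K : ℝ) ^ 2 * Real.exp (-δ / ε) ∧
          (∀ j j' : Fin K,
            DifferentiableAt ℝ (couplingEntry ε (vecs zq) (vecs zc) k j j') (vecs zq k)) ∧
          fullGrad ε (vecs zq) (vecs zc) k =
            directGrad ε (vecs zq) (vecs zc) k + indirectGrad ε (vecs zq) (vecs zc) k ∧
          ‖indirectGrad ε (vecs zq) (vecs zc) k‖ ≤
            4 * (K : ℝ) ^ 2 * (ε⁻¹ * Real.exp (-δ / ε))) ∧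
        Tendsto (fun ε : ℝ => indirectGrad ε (vecs zq) (vecs zc) k) (𝓝[>] 0) (𝓝 0)) ∧
    (K ≤ D → ∀ μ : Measure ((Fin K → Sph D) × (Fin K → Sph D)), μ ≪ surfaceMeasure K D →
      ∀ ε : ℝ, 0 < ε → μ {z | (jacobian ε (vecs z.1) (vecs z.2)).rank < K} = 0) := by
  refine ⟨fun δ hδ zq zc kstar hgap hmax hbij k => ?_,
    fun hD μ hμ ε hε => hμ (surfaceMeasure_rank_lt_eq_zero hK hD hε)⟩
  have hq (i : Fin K) : ‖vecs zq i‖ = 1 := by simp [vecs]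
  have hc (i : Fin K) : ‖vecs zc i‖ = 1 := by simp [vecs]
  have hmargin : HasRowMargin (simFun (vecs zq) (vecs zc)) kstar δ := hmax.hasRowMargin hgap
  refine ⟨fun ε hε => ?_, tendsto_indirectGrad_zero hδ hq hc hbij hmargin k⟩
  have hmass := one_sub_sinkhornFun_le hε hbij hmargin k
  have hdirect := norm_directGrad_sub_hardGrad_le hε hq hc hbij hmargin k
  have herror : 0 ≤ (K : ℝ) ^ 2 * Real.exp (-δ / ε) := by positivity
  exact ⟨by rw [coupling_eq_sinkhornFun]; linarith, by linarith,
    fun i j => (hasFDerivAt_couplingEntry hε hq hc k i j).differentiableAt,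
    fullGrad_eq_directGrad_add_indirectGrad hε hq hc k,
    norm_indirectGrad_le hε hq hc hbij hmargin k⟩

theorem mainTheorem7 (K : ℕ) (hK : 2 ≤ K) (δ : ℝ) (hδ : 0 < δ) :
    ∃ εcrit C c : ℝ, 0 < εcrit ∧ 0 < C ∧ 0 < c ∧
      ∀ D : ℕ,
        (∀ (zq zc : Fin K → SlotMatching.Sph D) (kstar : Fin K → Fin K),
          SlotMatching.minGap
            (SlotMatching.simMatrix (SlotMatching.vecs zq) (SlotMatching.vecs zc)) = δ →
          SlotMatching.IsRowArgmax
            (SlotMatching.simMatrix (SlotMatching.vecs zq) (SlotMatching.vecs zc)) kstar →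
          Function.Bijective kstar →
          ∀ k : Fin K,
            (∀ ε : ℝ, 0 < ε → ε < εcrit →
              1 - C * Real.exp (-c / ε) ≤
                SlotMatching.coupling ε (SlotMatching.vecs zq) (SlotMatching.vecs zc)
                  k (kstar k) ∧
              ‖SlotMatching.directGrad ε (SlotMatching.vecs zq) (SlotMatching.vecs zc) k -
                  SlotMatching.hardGrad (SlotMatching.vecs zq) (SlotMatching.vecs zc) kstar k‖ ≤
                C * Real.exp (-c / ε) ∧
              (∀ j j' : Fin K, DifferentiableAt ℝ
                (SlotMatching.couplingEntry ε (SlotMatching.vecs zq) (SlotMatching.vecs zc) k j j')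
                (SlotMatching.vecs zq k)) ∧
              SlotMatching.fullGrad ε (SlotMatching.vecs zq) (SlotMatching.vecs zc) k =
                SlotMatching.directGrad ε (SlotMatching.vecs zq) (SlotMatching.vecs zc) k +
                  SlotMatching.indirectGrad ε (SlotMatching.vecs zq) (SlotMatching.vecs zc) k ∧
              ‖SlotMatching.indirectGrad ε (SlotMatching.vecs zq) (SlotMatching.vecs zc) k‖ ≤
                C * (ε⁻¹ * Real.exp (-c / ε))) ∧
            Filter.Tendsto
              (fun ε : ℝ =>
                SlotMatching.indirectGrad ε (SlotMatching.vecs zq) (SlotMatching.vecs zc) k)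
              (nhdsWithin 0 (Set.Ioi 0)) (nhds 0)) ∧
        (2 * K ≤ D →
          ∀ μ : MeasureTheory.Measure
              ((Fin K → SlotMatching.Sph D) × (Fin K → SlotMatching.Sph D)),
            MeasureTheory.IsProbabilityMeasure μ →
            MeasureTheory.Measure.AbsolutelyContinuous μ (SlotMatching.surfaceMeasure K D) →
            ∀ ε : ℝ, 0 < ε → ε < εcrit →
              μ {z | (SlotMatching.jacobian ε (SlotMatching.vecs z.1)
                (SlotMatching.vecs z.2)).rank < K} = 0) := by
  exact ⟨1, 4 * (K : ℝ) ^ 2, δ, one_pos, by positivity, hδ, fun D =>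
    ⟨fun zq zc kstar hgap hmax hbij k =>
      ((mainTheorem7_general hK).1 δ hδ zq zc kstar hgap.ge hmax hbij k).imp_left
        fun hbound ε hε _ => hbound ε hε,
      fun hD μ _ hμ ε hε _ => (mainTheorem7_general hK).2 (by omega) μ hμ ε hε⟩⟩
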